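/- Identify the Euclidean plane with $\mathbb{C}$ and let $x=(p,X)$, $y=(q,Y)$ be two unit tangent vectors, i.e. $p,q\in\mathbb{C}$, $|X|=|Y|=1$. A bounded curvature path from $x$ to $y$ is a $C^1$ and piecewise $C^2$ path $\gamma:[0,s]\to\mathbb{C}$, $s>0$, parametrized by arc length, with $\gamma(0)=p$, $\gamma'(0)=X$, $\gamma(s)=q$, $\gamma'(s)=Y$, and $|\gamma''(t)|\le 1$ wherever $\gamma''(t)$ exists; $s$ is its length. Let $c_l(x)=p+iX$, $c_r(x)=p-iX$ be the centres of the two unit circles tangent to $x$, and similarly $c_l(y),c_r(y)$. Assume that $q$ lies in the forward region of $x$: $\langle X,q-p\rangle>0$, $|q-c_l(x)|\ge 1$ and $|q-c_r(x)|\ge 1$. Assume that $x,y$ carries a region $\Omega$. That is: $|c_l(x)-c_l(y)|<4$ and $|c_r(x)-c_r(y)|<4$; there are a path from $x$ to $y$ that is a concatenation of three arcs of unit circles turning left, right, left, and a path from $x$ to $y$ that is a concatenation of three arcs of unit circles turning right, left, right, all six arcs having length in $(0,\pi)$; these two paths together form a simple closed curve (each is injective, and they meet only at $p$ and $q$); and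 $\Omega$ is the closure of the bounded component of the complement of that curve. Let $\Delta(\Omega)$ be the set of embedded (injective) bounded curvature paths from $x$ to $y$ with image in $\Omega$. Then: 1. The paths in $\Delta(\Omega)$ have bounded length: there is $L$ such that every $\gamma\in\Delta(\Omega)$ has length at most $L$. 2. There is $L$ such that every bounded curvature path $\gamma:[0,s]\to\mathbb{C}$ from $x$ to $y$ (embedded or not) of length $s>L$ leaves $\Omega$ (i.e. $\gamma(t)\notin\Omega$ for some $t$), or has diameter $\max_{t_1,t_2}|\gamma(t_1)-\gamma(t_2)|>4$, or has parallel tangents, i.e. there are $t_1<t_2$ in $[0,s]$ with $\gamma'(t_2)=-\gamma'(t_1)$. -/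

import Mathlib

/-- A unit tangent vector of the Euclidean plane (modelled by `ℂ`): a base point and a unit vector.
An endpoint condition is a pair of these. -/
structure UnitTangent where
  base : ℂ
  dir : ℂ
  norm_dir : ‖dir‖ = 1

namespace UnitTangent

/-- Centre of the adjacent unit circle tangent to `u` on its left. -/
noncomputable def leftCenter (u : UnitTangent) : ℂ := u.base + Complex.I * u.dir

/-- Centre of the adjacent unit circle tangent to `u` on its right. -/
noncomputable def rightCenter (u : UnitTangent) : ℂ := u.base - Complex.I * u.dir

/-- The tangent vector reached from `u` after moving at unit speed for time `t` along the adjacent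
unit circle of `u` to the left (`ε = 1`, counterclockwise) or to the right (`ε = -1`, clockwise). -/
noncomputable def turn (u : UnitTangent) (ε : ℤˣ) (t : ℝ) : UnitTangent where
  base := (u.base + (ε : ℤ) * (Complex.I * u.dir)) -
    (ε : ℤ) * (Complex.I * u.dir) * Complex.exp (((((ε : ℤ) : ℝ) * t : ℝ) : ℂ) * Complex.I)
  dir := u.dir * Complex.exp (((((ε : ℤ) : ℝ) * t : ℝ) : ℂ) * Complex.I)
  norm_dir := by rw [norm_mul, u.norm_dir, Complex.norm_exp_ofReal_mul_I, one_mul]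

/-- The arc length parametrized concatenation, from `u`, of three arcs of unit circles of lengths
`a 0`, `a 1`, `a 2` and of alternating orientations `ε`, `-ε`, `ε`. -/
noncomputable def threeArcs (u : UnitTangent) (ε : ℤˣ) (a : Fin 3 → ℝ) (t : ℝ) : UnitTangent :=
  if t ≤ a 0 then u.turn ε t
  else if t ≤ a 0 + a 1 then (u.turn ε (a 0)).turn (-ε) (t - a 0)
  else ((u.turn ε (a 0)).turn (-ε) (a 1)).turn ε (t - a 0 - a 1)

/-- The set of points on the path `threeArcs u ε a`. -/
noncomputable def threeArcsTrace (u : UnitTangent) (ε : ℤˣ) (a : Fin 3 → ℝ) : Set ℂ :=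
  (fun t => (u.threeArcs ε a t).base) '' Set.Icc 0 (a 0 + a 1 + a 2)

/-- `threeArcs u ε a` is an injective path from `u` to `v` formed by three nontrivial arcs,
each of length less than `π`. -/
structure IsThreeArcPath (u v : UnitTangent) (ε : ℤˣ) (a : Fin 3 → ℝ) : Prop where
  pos : ∀ i, 0 < a i
  lt_pi : ∀ i, a i < Real.pi
  endpoint : u.threeArcs ε a (a 0 + a 1 + a 2) = v
  injOn : Set.InjOn (fun t => (u.threeArcs ε a t).base) (Set.Icc 0 (a 0 + a 1 + a 2))

/-- The forward region of `x`: the open half plane in front of `x`, minus the interiors of the two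
disks bounded by the adjacent circles of `x`. -/
def forwardRegion (x : UnitTangent) : Set ℂ :=
  {p | 0 < inner ℝ x.dir (p - x.base) ∧
    1 ≤ dist p x.leftCenter ∧ 1 ≤ dist p x.rightCenter}

end UnitTangent

/-- The union of the bounded connected components of the complement of `C`
(if `C` is a simple closed curve, there is exactly one). -/
def boundedComplement (C : Set ℂ) : Set ℂ :=
  {z | z ∈ Cᶜ ∧ Bornology.IsBounded (connectedComponentIn Cᶜ z)}

/-- The endpoint condition `x, y` carries the region `Ω`: corresponding adjacent circles have
centres at distance less than `4`, and there are a left-right-left and a right-left-right path from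
`x` to `y` which meet only at their endpoints, so that their six arcs form a simple closed curve;
`Ω` is the closure of the bounded component of the complement of this curve. -/
def CarriesRegion (x y : UnitTangent) (Ω : Set ℂ) : Prop :=
  dist x.leftCenter y.leftCenter < 4 ∧ dist x.rightCenter y.rightCenter < 4 ∧
  ∃ a b : Fin 3 → ℝ, x.IsThreeArcPath y 1 a ∧ x.IsThreeArcPath y (-1) b ∧
    x.threeArcsTrace 1 a ∩ x.threeArcsTrace (-1) b = {x.base, y.base} ∧
    Ω = closure (boundedComplement (x.threeArcsTrace 1 a ∪ x.threeArcsTrace (-1) b))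

/-- The velocity of a path defined on `[0, s]` (one-sided at the ends). -/
noncomputable def velocity (s : ℝ) (γ : ℝ → ℂ) (t : ℝ) : ℂ := derivWithin γ (Set.Icc 0 s) t

/-- `γ`, restricted to `[0, s]`, is a bounded curvature path (maximal curvature `1`) from `x`
to `y`. Its length is `s`. -/
structure IsBoundedCurvaturePath (x y : UnitTangent) (s : ℝ) (γ : ℝ → ℂ) : Prop where
  pos : 0 < s
  c1 : ContDiffOn ℝ 1 γ (Set.Icc 0 s)
  piecewise_c2 : ∃ (n : ℕ) (p : ℕ → ℝ), p 0 = 0 ∧ p n = s ∧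
    ∀ i < n, p i < p (i + 1) ∧ ContDiffOn ℝ 2 γ (Set.Icc (p i) (p (i + 1)))
  unit_speed : ∀ t ∈ Set.Icc 0 s, ‖velocity s γ t‖ = 1
  start_base : γ 0 = x.base
  start_dir : velocity s γ 0 = x.dir
  end_base : γ s = y.base
  end_dir : velocity s γ s = y.dir
  curvature : ∀ t ∈ Set.Icc 0 s, DifferentiableWithinAt ℝ (velocity s γ) (Set.Icc 0 s) t →
    ‖derivWithin (velocity s γ) (Set.Icc 0 s) t‖ ≤ 1

/-- The space `Δ(Ω)` of embedded bounded curvature paths from `x` to `y` in `Ω`; a path is given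
by its length and its arc length parametrization. -/
def embeddedPathsIn (x y : UnitTangent) (Ω : Set ℂ) : Set (ℝ × (ℝ → ℂ)) :=
  {P | IsBoundedCurvaturePath x y P.1 P.2 ∧ Set.InjOn P.2 (Set.Icc 0 P.1) ∧
    ∀ t ∈ Set.Icc 0 P.1, P.2 t ∈ Ω}

/-- The path has tangent vectors pointing in opposite directions at two parameters. -/
def HasParallelTangents (s : ℝ) (γ : ℝ → ℂ) : Prop :=
  ∃ t₁ ∈ Set.Icc 0 s, ∃ t₂ ∈ Set.Icc 0 s, t₁ < t₂ ∧ velocity s γ t₂ = -velocity s γ t₁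

/-!
A path of curvature at most `1` has a `1`-Lipschitz tangent angle `θ`. As long as `θ` varies by less
than `π`, the path advances steadily in some direction, which it can do only for a bounded time
inside a bounded set. So a long path of diameter at most `4` turns by `π` within every window of
some fixed length, and in particular it has parallel tangents.

For an embedded path in `Ω`, the total turning can be bounded as well. As the six arcs close up, all
their directions are within `π / 2` of a common direction `μ`. Consequently `Ω` lies in the strip
bounded by the normals to `μ` at `p` and `q`, and also in a disc of radius `r < 2`. A path whose
tangent angle rises by `ω` and later falls by `ω` has diameter at least `2 (1 - cos ω)`, so for
`ω < π` close to `π` this is impossible in such a disc: all windows turn the same way, and the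
total turning grows linearly with the length. On the other hand, it is at most `2π`: as in Hopf's
proof of the Umlaufsatz, it equals the turning of the secant, first with one end kept at `p`, then
with the other end kept at `q`, and in the strip these secants stay in a half-plane.
-/

open Set Filter Real
open scoped Topology

/-! ### Curves with a tangent angle -/

/-- The unit complex number with argument `t`. -/
noncomputable def cis (t : ℝ) : ℂ := Complex.exp (t * Complex.I)

theorem cis_re (t : ℝ) : (cis t).re = cos t := Complex.exp_ofReal_mul_I_re t

theorem cis_im (t : ℝ) : (cis t).im = sin t := Complex.exp_ofReal_mul_I_im t

theorem norm_cis (t : ℝ) : ‖cis t‖ = 1 := Complex.norm_exp_ofReal_mul_I t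

theorem cis_ne_zero (t : ℝ) : cis t ≠ 0 := Complex.exp_ne_zero _

theorem cis_add (s t : ℝ) : cis (s + t) = cis s * cis t := by
  rw [cis, cis, cis, ← Complex.exp_add]
  push_cast
  ring_nf

theorem cis_add_pi (t : ℝ) : cis (t + π) = -cis t := by
  simp [cis, add_mul, Complex.exp_add]

theorem conj_cis (t : ℝ) : (starRingEnd ℂ) (cis t) = cis (-t) := by
  apply Complex.ext <;> simp [cis_re, cis_im]

theorem exp_eq_norm_mul_cis_im (z : ℂ) : Complex.exp z = ‖Complex.exp z‖ * cis z.im := by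
  rw [Complex.norm_exp, cis, Complex.ofReal_exp, ← Complex.exp_add, Complex.re_add_im]

theorem hasDerivAt_cis (t : ℝ) : HasDerivAt cis (cis t * Complex.I) t := by
  have h : HasDerivAt (fun t : ℝ => (t : ℂ) * Complex.I) Complex.I t := by
    simpa using (Complex.ofRealCLM.hasDerivAt (x := t)).mul_const Complex.I
  exact h.cexp

theorem continuous_cis : Continuous cis :=
  continuous_iff_continuousAt.2 fun t => (hasDerivAt_cis t).continuousAt

theorem mul_sub_le_sub_of_le_hasDerivAt {f f' : ℝ → ℝ} {a b C : ℝ} (hab : a ≤ b)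
    (hf : ∀ t, HasDerivAt f (f' t) t) (hC : ∀ t ∈ Icc a b, C ≤ f' t) :
    C * (b - a) ≤ f b - f a :=
  (convex_Icc a b).mul_sub_le_image_sub_of_le_deriv
    (fun t _ => (hf t).continuousAt.continuousWithinAt)
    (fun t _ => (hf t).differentiableAt.differentiableWithinAt)
    (fun t ht => (hf t).deriv.symm ▸ hC t (interior_subset ht))
    a (left_mem_Icc.2 hab) b (right_mem_Icc.2 hab) hab

theorem sub_le_sub_of_eventually_sub_lt_mul {f B B' : ℝ → ℝ} {a b : ℝ} (hab : a ≤ b)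
    (hf : Continuous f) (hB : ∀ t ∈ Icc a b, HasDerivAt B (B' t) t)
    (hslope : ∀ x r, B' x < r → ∀ᶠ z in 𝓝[>] x, f z - f x < r * (z - x)) :
    f b - f a ≤ B b - B a := by
  suffices f b ≤ B b - (B a - f a) by linarith
  refine image_le_of_liminf_slope_right_le_deriv_boundary (B := fun t => B t - (B a - f a))
    hf.continuousOn (by simp)
    (fun t ht => ((hB t ht).sub_const _).continuousAt.continuousWithinAt)
    (fun t ht => ((hB t (Ico_subset_Icc_self ht)).sub_const _).hasDerivWithinAt)
    (fun x _ r hr => ?_) (right_mem_Icc.2 hab)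
  refine (((hslope x r hr).and self_mem_nhdsWithin).mono fun z hz => ?_).frequently
  rw [slope_def_field, div_lt_iff₀ (sub_pos.2 hz.2)]
  exact hz.1

theorem tendsto_norm_dslope_comp {E : Type*} [NormedAddCommGroup E] [NormedSpace ℝ E]
    {f : ℝ → E} {f' : E} {θ : ℝ → ℝ} (hθ : Continuous θ) {x : ℝ} (hf : HasDerivAt f f' (θ x)) :
    Tendsto (fun z => ‖dslope f (θ x) (θ z)‖) (𝓝[>] x) (𝓝 ‖f'‖) := by
  have hcont : ContinuousAt (dslope f (θ x)) (θ x) :=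
    continuousAt_dslope_same.2 hf.differentiableAt
  have hlim := (hcont.comp hθ.continuousAt).norm.tendsto
  simp only [Function.comp_apply, dslope_same, hf.deriv] at hlim
  exact hlim.mono_left nhdsWithin_le_nhds

theorem comp_sub_comp_le_of_lipschitzWith {f f' θ B : ℝ → ℝ} {a b : ℝ} (hab : a ≤ b)
    (hf : ∀ t, HasDerivAt f (f' t) t) (hθ : LipschitzWith 1 θ)
    (hB : ∀ t ∈ Icc a b, HasDerivAt B |f' (θ t)| t) :
    f (θ b) - f (θ a) ≤ B b - B a := by
  have hfc : Continuous f := continuous_iff_continuousAt.2 fun t => (hf t).continuousAt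
  refine sub_le_sub_of_eventually_sub_lt_mul hab (hfc.comp hθ.continuous) hB fun x r hr => ?_
  filter_upwards [(tendsto_norm_dslope_comp hθ.continuous (hf (θ x))).eventually_lt_const hr,
    self_mem_nhdsWithin] with z hz hxz
  have hxz' : 0 < z - x := sub_pos.2 hxz
  have hθxz : |θ z - θ x| ≤ z - x := by
    simpa [Real.dist_eq, abs_of_pos hxz'] using hθ.dist_le_mul z x
  calc f (θ z) - f (θ x) = (θ z - θ x) * dslope f (θ x) (θ z) := (sub_smul_dslope f _ _).symm
    _ ≤ |θ z - θ x| * ‖dslope f (θ x) (θ z)‖ := (le_abs_self _).trans (abs_mul _ _).le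
    _ ≤ (z - x) * ‖dslope f (θ x) (θ z)‖ := by gcongr
    _ < r * (z - x) := by rw [mul_comm]; gcongr

theorem exists_eq_and_forall_Icc_le {θ : ℝ → ℝ} (hθ : Continuous θ) {t m c : ℝ} (htm : t ≤ m)
    (ht : θ t ≤ c) (hm : c ≤ θ m) : ∃ a ∈ Icc t m, θ a = c ∧ ∀ u ∈ Icc a m, c ≤ θ u := by
  obtain ⟨a, ⟨ha, hac⟩, hmax⟩ := (isCompact_Icc.inter_right
    (isClosed_singleton.preimage hθ)).exists_isGreatest
    (intermediate_value_Icc htm hθ.continuousOn ⟨ht, hm⟩)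
  refine ⟨a, ha, hac, fun u hu => ?_⟩
  by_contra! huc
  obtain ⟨v, hv, hvc⟩ := intermediate_value_Icc hu.2 hθ.continuousOn ⟨huc.le, hm⟩
  have hva : v ≤ a := hmax ⟨⟨ha.1.trans (hu.1.trans hv.1), hv.2⟩, hvc⟩
  have hua : u = a := le_antisymm (hv.1.trans hva) hu.1
  exact huc.ne (hua ▸ hac)

/-- The curve `Γ` moves at unit speed in the direction `θ`, which turns at speed at most `1`.
This is a curve of curvature at most `1`, defined for all times, together with a continuous choice
of its tangent angle. -/
structure HasTangentAngle (Γ : ℝ → ℂ) (θ : ℝ → ℝ) : Prop where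
  hasDerivAt (t : ℝ) : HasDerivAt Γ (cis (θ t)) t
  lipschitzWith : LipschitzWith 1 θ

namespace HasTangentAngle

variable {Γ : ℝ → ℂ} {θ : ℝ → ℝ} (h : HasTangentAngle Γ θ)

include h

theorem continuous : Continuous Γ :=
  continuous_iff_continuousAt.2 fun t => (h.hasDerivAt t).continuousAt

theorem rotate (c : ℝ) : HasTangentAngle (fun t => cis (-c) * Γ t) (fun t => θ t - c) where
  hasDerivAt t := by
    have hcis : cis (θ t - c) = cis (-c) * cis (θ t) := by rw [← cis_add, neg_add_eq_sub]
    exact hcis ▸ (h.hasDerivAt t).const_mul (cis (-c))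
  lipschitzWith := LipschitzWith.of_dist_le_mul fun t t' => by
    simpa using h.lipschitzWith.dist_le_mul t t'

theorem conj : HasTangentAngle (fun t => (starRingEnd ℂ) (Γ t)) (-θ) where
  hasDerivAt t := by
    rw [Pi.neg_apply, ← conj_cis]
    exact (h.hasDerivAt t).star
  lipschitzWith := h.lipschitzWith.neg

theorem hasDerivAt_re (t : ℝ) : HasDerivAt (fun t => (Γ t).re) (cos (θ t)) t :=
  cis_re (θ t) ▸ Complex.reCLM.hasFDerivAt.comp_hasDerivAt t (h.hasDerivAt t)

theorem hasDerivAt_im (t : ℝ) : HasDerivAt (fun t => (Γ t).im) (sin (θ t)) t :=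
  cis_im (θ t) ▸ Complex.imCLM.hasFDerivAt.comp_hasDerivAt t (h.hasDerivAt t)

theorem abs_cos_sub_cos_le_im_sub_im {a b : ℝ} (hab : a ≤ b)
    (hsin : ∀ t ∈ Icc a b, 0 ≤ sin (θ t)) :
    |cos (θ b) - cos (θ a)| ≤ (Γ b).im - (Γ a).im := by
  have hcos : cos (θ b) - cos (θ a) ≤ (Γ b).im - (Γ a).im :=
    comp_sub_comp_le_of_lipschitzWith hab hasDerivAt_cos h.lipschitzWith fun t ht => by
      rw [abs_neg, abs_of_nonneg (hsin t ht)]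
      exact h.hasDerivAt_im t
  have hneg : -cos (θ b) - -cos (θ a) ≤ (Γ b).im - (Γ a).im :=
    comp_sub_comp_le_of_lipschitzWith (f := fun t => -cos t) hab
      (fun t => (hasDerivAt_cos t).neg) h.lipschitzWith fun t ht => by
        rw [neg_neg, abs_of_nonneg (hsin t ht)]
        exact h.hasDerivAt_im t
  exact abs_sub_le_iff.2 ⟨hcos, by linarith⟩

theorem exists_two_mul_one_sub_cos_le_dist {ω t₁ t₂ t₃ : ℝ} (hω₀ : 0 ≤ ω) (hω : ω ≤ π)
    (h₁₂ : t₁ ≤ t₂) (h₂₃ : t₂ ≤ t₃) (hup : θ t₁ + ω ≤ θ t₂) (hdown : θ t₃ + ω ≤ θ t₂) :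
    ∃ a ∈ Icc t₁ t₃, ∃ b ∈ Icc t₁ t₃, 2 * (1 - cos ω) ≤ dist (Γ a) (Γ b) := by
  have hθ := h.lipschitzWith.continuous
  obtain ⟨m, hm, hmax⟩ := isCompact_Icc.exists_isMaxOn ⟨t₂, h₁₂, h₂₃⟩ hθ.continuousOn
  have hθm : θ t₂ ≤ θ m := hmax ⟨h₁₂, h₂₃⟩
  set c := θ m - ω
  obtain ⟨a, ha, hθa, hca⟩ := exists_eq_and_forall_Icc_le hθ (c := c) hm.1 (by linarith)
    (by linarith)
  obtain ⟨b, hb, hθb, hcb⟩ := exists_eq_and_forall_Icc_le (hθ.comp continuous_neg) (c := c)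
    (neg_le_neg hm.2) (by simpa using by linarith) (by simpa using by linarith)
  have hm_b : m ≤ -b := by linarith [hb.2]
  have hsin_rotate : ∀ t ∈ Icc t₁ t₃, c ≤ θ t → 0 ≤ sin (θ t - c) := fun t ht hct =>
    sin_nonneg_of_nonneg_of_le_pi (by linarith) (by linarith [isMaxOn_iff.1 hmax t ht])
  have hrise := (h.rotate c).abs_cos_sub_cos_le_im_sub_im ha.2 fun t ht =>
    hsin_rotate t ⟨ha.1.trans ht.1, ht.2.trans hm.2⟩ (hca t ht)
  have hfall := (h.rotate c).abs_cos_sub_cos_le_im_sub_im hm_b fun t ht =>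
    hsin_rotate t ⟨hm.1.trans ht.1, ht.2.trans (by linarith [hb.1])⟩
      (by simpa using hcb (-t) ⟨by linarith [ht.2], by linarith [ht.1]⟩)
  have hmc : θ m - c = ω := by ring
  rw [hθa, sub_self, hmc, cos_zero] at hrise
  rw [show θ (-b) = c from hθb, sub_self, hmc, cos_zero] at hfall
  refine ⟨-b, ⟨by linarith [hm.1], by linarith [hb.1]⟩, a, ⟨ha.1, ha.2.trans hm.2⟩, ?_⟩
  calc 2 * (1 - cos ω) ≤ (cis (-c) * Γ (-b)).im - (cis (-c) * Γ a).im := by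
        linarith [neg_abs_le (cos ω - 1), le_abs_self (1 - cos ω)]
    _ = (cis (-c) * (Γ (-b) - Γ a)).im := by rw [mul_sub, Complex.sub_im]
    _ ≤ ‖cis (-c) * (Γ (-b) - Γ a)‖ := (le_abs_self _).trans (Complex.abs_im_le_norm _)
    _ = dist (Γ (-b)) (Γ a) := by rw [norm_mul, norm_cis, one_mul, dist_eq_norm]

end HasTangentAngle

namespace HasTangentAngle

variable {Γ : ℝ → ℂ} {θ : ℝ → ℝ} (h : HasTangentAngle Γ θ) {D : ℝ}

include h

theorem exists_three_quarters_le_cos {a b : ℝ} (hab : a < b)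
    (hcos : ∀ t ∈ Icc a b, 0 ≤ cos (θ t)) (hD : 2 * dist (Γ a) (Γ b) ≤ b - a) :
    ∃ c ∈ Icc a b, 3 / 4 ≤ cos (θ c) := by
  obtain ⟨c, hc, hslope⟩ := exists_hasDerivAt_eq_slope (fun t => (Γ t).im) _ hab
    (fun t _ => (h.hasDerivAt_im t).continuousAt.continuousWithinAt)
    fun t _ => h.hasDerivAt_im t
  have him : |(Γ b).im - (Γ a).im| ≤ dist (Γ a) (Γ b) := by
    rw [dist_comm, dist_eq_norm, ← Complex.sub_im]
    exact Complex.abs_im_le_norm _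
  have hsin : |sin (θ c)| ≤ 1 / 2 := by
    rw [hslope, abs_div, abs_of_pos (sub_pos.2 hab), div_le_iff₀ (sub_pos.2 hab)]
    linarith
  have hsq : sin (θ c) ^ 2 ≤ (1 / 2) ^ 2 := sq_le_sq' (abs_le.1 hsin).1 (abs_le.1 hsin).2
  have hc' := Ioo_subset_Icc_self hc
  exact ⟨c, hc', by nlinarith [sin_sq_add_cos_sq (θ c), hcos c hc', cos_le_one (θ c)]⟩

theorem one_eighth_le_re_sub_re {a b : ℝ} (hab : a + 1 / 2 ≤ b)
    (hcos : ∀ t ∈ Icc a b, 0 ≤ cos (θ t)) (hD : 2 * dist (Γ a) (Γ b) ≤ b - a) :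
    1 / 8 ≤ (Γ b).re - (Γ a).re := by
  obtain ⟨c, hc, hcos_c⟩ := h.exists_three_quarters_le_cos (by linarith) hcos hD
  obtain ⟨u, hau, hub, huc⟩ : ∃ u, a ≤ u ∧ u + 1 / 4 ≤ b ∧ c ∈ Icc u (u + 1 / 4) := by
    rcases le_total (c + 1 / 4) b with hcb | hcb
    · exact ⟨c, hc.1, hcb, le_rfl, by linarith⟩
    · exact ⟨c - 1 / 4, by linarith, by linarith [hc.2], by linarith, by linarith⟩
  have hhalf : ∀ t ∈ Icc u (u + 1 / 4), 1 / 2 ≤ cos (θ t) := fun t ht => by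
    have hθ : |θ c - θ t| ≤ 1 / 4 := by
      have hct : |c - t| ≤ 1 / 4 := abs_le.2 ⟨by linarith [huc.1, ht.2], by linarith [huc.2, ht.1]⟩
      have hlip := h.lipschitzWith.dist_le_mul c t
      rw [Real.dist_eq, Real.dist_eq, NNReal.coe_one, one_mul] at hlip
      exact hlip.trans hct
    linarith [(le_abs_self _).trans ((abs_cos_sub_cos_le (θ c) (θ t)).trans hθ)]
  have hbefore := mul_sub_le_sub_of_le_hasDerivAt hau h.hasDerivAt_re fun t ht =>
    hcos t ⟨ht.1, by linarith [ht.2]⟩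
  have hmiddle := mul_sub_le_sub_of_le_hasDerivAt (by linarith) h.hasDerivAt_re hhalf
  have hafter := mul_sub_le_sub_of_le_hasDerivAt hub h.hasDerivAt_re fun t ht =>
    hcos t ⟨by linarith [ht.1], ht.2⟩
  linarith

theorem length_lt_of_cos_nonneg {a b : ℝ} (hab : a ≤ b) (hcos : ∀ t ∈ Icc a b, 0 ≤ cos (θ t))
    (hD : ∀ t ∈ Icc a b, ∀ t' ∈ Icc a b, dist (Γ t) (Γ t') ≤ D) :
    b - a < (8 * D + 1) * (2 * D + 1) := by
  have hD₀ : 0 ≤ D :=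
    dist_nonneg.trans (hD a (left_mem_Icc.2 hab) a (left_mem_Icc.2 hab))
  by_contra! hlong
  set W := 2 * D + 1
  have hmem : ∀ k : ℕ, a + k * W ≤ b → a + k * W ∈ Icc a b := fun k hk =>
    ⟨by simp only [le_add_iff_nonneg_right]; positivity, hk⟩
  have hgain : ∀ k : ℕ, a + k * W ≤ b → k / 8 ≤ (Γ (a + k * W)).re - (Γ a).re := by
    intro k
    induction k with
    | zero => simp
    | succ k ih =>
      intro hk
      have hstep : a + (k + 1 : ℕ) * W = a + k * W + W := by push_cast; ring
      have hk' : a + k * W ≤ b := by linarith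
      have hwindow := h.one_eighth_le_re_sub_re (a := a + k * W) (b := a + (k + 1 : ℕ) * W)
        (by linarith) (fun t ht => hcos t ⟨(hmem k hk').1.trans ht.1, ht.2.trans hk⟩)
        (by linarith [hD _ (hmem k hk') _ (hmem (k + 1) hk)])
      push_cast at hwindow ⊢
      linarith [ih hk']
  have hfloor := Nat.lt_floor_add_one (8 * D)
  have hk : a + (⌊8 * D⌋₊ + 1 : ℕ) * W ≤ b := by
    have : (⌊8 * D⌋₊ : ℝ) * W ≤ 8 * D * W := by gcongr; exact Nat.floor_le (by positivity)
    push_cast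
    linarith
  have hre : (Γ (a + (⌊8 * D⌋₊ + 1 : ℕ) * W)).re - (Γ a).re ≤ D := by
    rw [← Complex.sub_re]
    refine (Complex.re_le_norm _).trans ?_
    rw [← dist_eq_norm]
    exact hD _ (hmem _ hk) _ (left_mem_Icc.2 hab)
  have := hgain _ hk
  push_cast at this hre
  linarith

end HasTangentAngle

/-- Between some two successive times in `S`, the function `θ` rises by at least `P`. -/
def RisesOn (θ : ℝ → ℝ) (P : ℝ) (S : Set ℝ) : Prop :=
  ∃ t ∈ S, ∃ t' ∈ S, t ≤ t' ∧ θ t + P ≤ θ t'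

theorem RisesOn.exists_eq_add {θ : ℝ → ℝ} {P a b : ℝ} (h : RisesOn θ P (Icc a b)) (hP : 0 < P)
    (hθ : Continuous θ) : ∃ t ∈ Icc a b, ∃ t' ∈ Icc a b, t < t' ∧ θ t' = θ t + P := by
  obtain ⟨t, ht, t', ht', htt', hrise⟩ := h
  obtain ⟨u, hu, hθu⟩ := intermediate_value_Icc htt' hθ.continuousOn
    (show θ t + P ∈ Icc (θ t) (θ t') from ⟨by linarith, hrise⟩)
  refine ⟨t, ht, u, ⟨ht.1.trans hu.1, hu.2.trans ht'.2⟩, hu.1.lt_of_ne ?_, hθu⟩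
  rintro rfl
  linarith

/-- On `S`, the function `θ` never rises by `ω` and later falls by `ω`. -/
def NoPeak (θ : ℝ → ℝ) (ω : ℝ) (S : Set ℝ) : Prop :=
  ∀ t₁ ∈ S, ∀ t₂ ∈ S, ∀ t₃ ∈ S, t₁ ≤ t₂ → t₂ ≤ t₃ → θ t₁ + ω ≤ θ t₂ → θ t₂ < θ t₃ + ω

namespace HasTangentAngle

variable {Γ : ℝ → ℂ} {θ : ℝ → ℝ} (h : HasTangentAngle Γ θ) {D : ℝ}

include h

theorem risesOn_pi_or_neg {a b : ℝ} (hab : a ≤ b)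
    (hD : ∀ t ∈ Icc a b, ∀ t' ∈ Icc a b, dist (Γ t) (Γ t') ≤ D)
    (hlong : (8 * D + 1) * (2 * D + 1) ≤ b - a) :
    RisesOn θ π (Icc a b) ∨ RisesOn (-θ) π (Icc a b) := by
  have hθ := h.lipschitzWith.continuous.continuousOn (s := Icc a b)
  obtain ⟨m, hm, hmin⟩ := isCompact_Icc.exists_isMinOn (nonempty_Icc.2 hab) hθ
  obtain ⟨M, hM, hmax⟩ := isCompact_Icc.exists_isMaxOn (nonempty_Icc.2 hab) hθ
  rcases le_or_gt (θ m + π) (θ M) with hvar | hvar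
  · rcases le_total m M with hmM | hMm
    · exact .inl ⟨m, hm, M, hM, hmM, hvar⟩
    · exact .inr ⟨M, hM, m, hm, hMm, by simp only [Pi.neg_apply]; linarith⟩
  · refine absurd ((h.rotate ((θ m + θ M) / 2)).length_lt_of_cos_nonneg (D := D) hab
      (fun t ht => ?_) fun t ht t' ht' => ?_) hlong.not_gt
    · have hm_le := isMinOn_iff.1 hmin t ht
      have hle_M := isMaxOn_iff.1 hmax t ht
      exact cos_nonneg_of_mem_Icc ⟨by linarith, by linarith⟩
    · rw [dist_eq_norm, ← mul_sub, norm_mul, norm_cis, one_mul, ← dist_eq_norm]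
      exact hD t ht t' ht'

theorem noPeak {ω s : ℝ} (hω₀ : 0 ≤ ω) (hω : ω ≤ π)
    (hD : ∀ t ∈ Icc 0 s, ∀ t' ∈ Icc 0 s, dist (Γ t) (Γ t') < 2 * (1 - cos ω)) :
    NoPeak θ ω (Icc 0 s) := by
  intro t₁ ht₁ t₂ _ t₃ ht₃ h₁₂ h₂₃ hup
  by_contra! hdown
  obtain ⟨a, ha, b, hb, hle⟩ := h.exists_two_mul_one_sub_cos_le_dist hω₀ hω h₁₂ h₂₃ hup hdown
  have hsub := Icc_subset_Icc ht₁.1 ht₃.2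
  exact (hD a (hsub ha) b (hsub hb)).not_ge hle

end HasTangentAngle

namespace NoPeak

variable {θ : ℝ → ℝ} {ω P s T : ℝ}

theorem not_risesOn_neg {a b c d : ℝ} (hpeak : NoPeak θ ω (Icc 0 s)) (hωP : ω < P)
    (ha : 0 ≤ a) (hbc : b ≤ c) (hd : d ≤ s) (hrise : RisesOn θ P (Icc a b)) :
    ¬RisesOn (-θ) P (Icc c d) := by
  rintro ⟨u, hu, u', hu', huu', hfall⟩
  obtain ⟨t, ht, t', ht', htt', hrise⟩ := hrise
  simp only [Pi.neg_apply] at hfall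
  have ht_mem : t ∈ Icc 0 s := ⟨by linarith [ht.1], by linarith [ht'.2, hu.1, hu'.2]⟩
  have ht'_mem : t' ∈ Icc 0 s := ⟨by linarith [ht.1], by linarith [ht'.2, hu.1, hu'.2]⟩
  have hu_mem : u ∈ Icc 0 s := ⟨by linarith [ht.1, ht'.2, hu.1], by linarith [hu'.2]⟩
  have hu'_mem : u' ∈ Icc 0 s := ⟨by linarith [ht.1, ht'.2, hu.1], by linarith [hu'.2]⟩
  have htu : t' ≤ u := by linarith [ht'.2, hu.1]
  have hpeak_t' := hpeak t ht_mem t' ht'_mem u' hu'_mem htt' (by linarith) (by linarith)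
  have hpeak_u := hpeak t ht_mem u hu_mem u' hu'_mem (by linarith) huu' (by linarith)
  linarith

theorem lt_add_of_risesOn (hpeak : NoPeak θ ω (Icc 0 s)) (hvalley : NoPeak (-θ) ω (Icc 0 s))
    (hωP : ω < P) (hT : 0 ≤ T) (n : ℕ)
    (hrise : ∀ k ≤ n, RisesOn θ P (Icc (k * T) ((k + 1) * T))) {u : ℝ}
    (hu : u ∈ Icc ((n + 1) * T) s) : θ 0 + (n + 1) * (P - ω) < θ u + ω := by
  induction n generalizing u with
  | zero =>
    obtain ⟨t, ht, t', ht', htt', hrise⟩ := hrise 0 le_rfl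
    simp only [Nat.cast_zero, zero_mul, zero_add, one_mul, mem_Icc] at ht ht' hu ⊢
    have h0_mem : (0 : ℝ) ∈ Icc 0 s := ⟨le_rfl, by linarith⟩
    have ht_mem : t ∈ Icc 0 s := ⟨ht.1, by linarith⟩
    have ht'_mem : t' ∈ Icc 0 s := ⟨ht'.1, by linarith⟩
    have hstart : θ 0 < θ t + ω := by
      by_contra! hfall
      have := hvalley 0 h0_mem t ht_mem t' ht'_mem ht.1 htt' (by simpa using by linarith)
      simp only [Pi.neg_apply] at this
      linarith
    have := hpeak t ht_mem t' ht'_mem u ⟨by linarith, hu.2⟩ htt' (by linarith) (by linarith)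
    linarith
  | succ n ih =>
    obtain ⟨t, ht, t', ht', htt', hrise_n⟩ := hrise (n + 1) le_rfl
    push_cast at ht ht' hu ⊢
    have hn : 0 ≤ (n + 1) * T := by positivity
    have htu : t' ≤ u := ht'.2.trans hu.1
    have hlow := ih (fun k hk => hrise k (by lia)) (u := t)
      ⟨ht.1, htt'.trans (htu.trans hu.2)⟩
    have := hpeak t ⟨hn.trans ht.1, htt'.trans (htu.trans hu.2)⟩ t'
      ⟨hn.trans ht'.1, htu.trans hu.2⟩ u ⟨hn.trans (ht'.1.trans htu), hu.2⟩ htt' htu (by linarith)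
    linarith

theorem risesOn_of_risesOn_zero (hpeak : NoPeak θ ω (Icc 0 s)) (hωP : ω < P) (hT : 0 ≤ T) {n : ℕ}
    (hn : (n + 1) * T ≤ s) (hwindow : ∀ k ≤ n, RisesOn θ P (Icc (k * T) ((k + 1) * T)) ∨
      RisesOn (-θ) P (Icc (k * T) ((k + 1) * T)))
    (hfirst : RisesOn θ P (Icc 0 T)) {k : ℕ} (hk : k ≤ n) :
    RisesOn θ P (Icc (k * T) ((k + 1) * T)) := by
  rcases k.eq_zero_or_pos with rfl | hk₀
  · simpa using hfirst
  · have hle : T ≤ k * T := le_mul_of_one_le_left hT (by exact_mod_cast hk₀)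
    have hend : (k + 1) * T ≤ s := le_trans (by gcongr) hn
    exact (hwindow k hk).resolve_right
      (hpeak.not_risesOn_neg hωP le_rfl hle hend hfirst)

theorem le_of_abs_sub_le {K : ℝ} (hpeak : NoPeak θ ω (Icc 0 s))
    (hvalley : NoPeak (-θ) ω (Icc 0 s)) (hωP : ω < P) (hT : 0 < T)
    (hwindow : ∀ a, 0 ≤ a → a + T ≤ s →
      RisesOn θ P (Icc a (a + T)) ∨ RisesOn (-θ) P (Icc a (a + T)))
    (hK : |θ s - θ 0| ≤ K) (hKω : 0 ≤ K + ω) : s ≤ ((K + ω) / (P - ω) + 1) * T := by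
  by_contra! hs
  have hPω : 0 < P - ω := sub_pos.2 hωP
  set n := ⌊(K + ω) / (P - ω)⌋₊
  have hfloor : K + ω < (n + 1) * (P - ω) := (div_lt_iff₀ hPω).1 (Nat.lt_floor_add_one _)
  have hend : (n + 1) * T ≤ s := by
    refine le_trans ?_ hs.le
    gcongr
    exact Nat.floor_le (by positivity)
  have hwindow_nat : ∀ k ≤ n, RisesOn θ P (Icc (k * T) ((k + 1) * T)) ∨
      RisesOn (-θ) P (Icc (k * T) ((k + 1) * T)) := fun k hk => by
    rw [add_one_mul (k : ℝ) T]
    refine hwindow (k * T) (by positivity) (le_trans ?_ hend)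
    rw [← add_one_mul]
    gcongr
  obtain ⟨hlow, hhigh⟩ := abs_le.1 hK
  have hfirst := hwindow_nat 0 n.zero_le
  simp only [Nat.cast_zero, zero_mul, zero_add, one_mul] at hfirst
  rcases hfirst with hrise | hfall
  · linarith [hpeak.lt_add_of_risesOn hvalley hωP hT.le n
      (fun k => hpeak.risesOn_of_risesOn_zero hωP hT.le hend hwindow_nat hrise) ⟨hend, le_rfl⟩]
  · have := hvalley.lt_add_of_risesOn (by rwa [neg_neg]) hωP hT.le n
      (fun k => hvalley.risesOn_of_risesOn_zero hωP hT.le hend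
        (fun k hk => by simpa only [neg_neg] using (hwindow_nat k hk).symm) hfall) ⟨hend, le_rfl⟩
    simp only [Pi.neg_apply] at this
    linarith

end NoPeak

/-! ### Tangent and secant angles -/

theorem sub_eq_sub_of_cis_eq {φ ψ : ℝ → ℝ} {S : Set ℝ} (hS : IsPreconnected S)
    (hφ : ContinuousOn φ S) (hψ : ContinuousOn ψ S) (h : ∀ t ∈ S, cis (φ t) = cis (ψ t)) {a b : ℝ}
    (ha : a ∈ S) (hb : b ∈ S) : φ b - φ a = ψ b - ψ a := by
  have hone : ∀ t ∈ S, Circle.exp (φ t - ψ t) = 1 := fun t ht => by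
    rw [Circle.exp_sub, div_eq_one]
    exact Circle.ext (h t ht)
  have hconst := Circle.isCoveringMap_exp.constOn_of_comp hS (hφ.sub hψ)
    (fun t ht t' ht' => (hone t ht).trans (hone t' ht').symm) ha hb
  simp only [Pi.sub_apply] at hconst
  linarith

theorem abs_sub_le_pi_of_cos_nonneg {φ : ℝ → ℝ} {S : Set ℝ} (hS : IsPreconnected S)
    (hφ : ContinuousOn φ S) (h : ∀ t ∈ S, 0 ≤ cos (φ t)) {a b : ℝ} (ha : a ∈ S) (hb : b ∈ S) :
    |φ b - φ a| ≤ π := by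
  have hslit : ∀ t ∈ S, cis (φ t) ∈ Complex.slitPlane := fun t ht => by
    rw [Complex.mem_slitPlane_iff, cis_re, cis_im]
    by_contra! hc
    nlinarith [sin_sq_add_cos_sq (φ t), h t ht]
  have harg : ∀ t ∈ S, |(cis (φ t)).arg| ≤ π / 2 := fun t ht =>
    Complex.abs_arg_le_pi_div_two_iff.2 (by rw [cis_re]; exact h t ht)
  have hsub := sub_eq_sub_of_cis_eq (ψ := fun t => (cis (φ t)).arg) hS hφ
    (Complex.continuousOn_arg.comp (continuous_cis.comp_continuousOn hφ) hslit)
    (fun t _ => by simpa [norm_cis, cis] using (Complex.norm_mul_exp_arg_mul_I (cis (φ t))).symm)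
    ha hb
  rw [hsub]
  exact (abs_sub _ _).trans (by linarith [harg a ha, harg b hb])

theorem sub_le_sub_of_lipschitzWith_cis {θ : ℝ → ℝ} (hθ : Continuous θ)
    (hcis : LipschitzWith 1 fun t => cis (θ t)) {a b : ℝ} (hab : a ≤ b) :
    θ b - θ a ≤ b - a := by
  refine sub_le_sub_of_eventually_sub_lt_mul (B := id) (B' := 1) hab hθ
    (fun t _ => hasDerivAt_id t) fun x r hr => ?_
  have hr₀ : 0 < r := zero_lt_one.trans hr
  have hlim := tendsto_norm_dslope_comp hθ (hasDerivAt_cis (θ x))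
  rw [norm_mul, norm_cis, Complex.norm_I, one_mul] at hlim
  filter_upwards [hlim.eventually_const_lt (inv_lt_one_of_one_lt₀ hr), self_mem_nhdsWithin]
    with z hz hxz
  have hxz' : 0 < z - x := sub_pos.2 hxz
  rcases le_or_gt (θ z) (θ x) with hle | hlt
  · exact (sub_nonpos.2 hle).trans_lt (by positivity)
  have hchord : |θ z - θ x| * ‖dslope cis (θ x) (θ z)‖ ≤ z - x := by
    rw [← Real.norm_eq_abs, ← norm_smul, sub_smul_dslope, ← dist_eq_norm]
    simpa [Real.dist_eq, abs_of_pos hxz'] using hcis.dist_le_mul z x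
  rw [abs_of_pos (sub_pos.2 hlt)] at hchord
  have : (θ z - θ x) * r⁻¹ < z - x :=
    (mul_lt_mul_of_pos_left hz (sub_pos.2 hlt)).trans_le hchord
  rwa [← div_eq_mul_inv, div_lt_iff₀' hr₀] at this

theorem lipschitzWith_of_lipschitzWith_cis {θ : ℝ → ℝ} (hθ : Continuous θ)
    (hcis : LipschitzWith 1 fun t => cis (θ t)) : LipschitzWith 1 θ := by
  have hneg : LipschitzWith 1 fun t => cis ((-θ) t) := LipschitzWith.of_dist_le_mul fun t t' => by
    simpa only [Pi.neg_apply, ← conj_cis, Complex.dist_conj_conj] using hcis.dist_le_mul t t'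
  refine LipschitzWith.of_le_add fun t t' => ?_
  rcases le_total t' t with hle | hle
  · rw [Real.dist_eq, abs_of_nonneg (sub_nonneg.2 hle)]
    linarith [sub_le_sub_of_lipschitzWith_cis hθ hcis hle]
  · rw [dist_comm, Real.dist_eq, abs_of_nonneg (sub_nonneg.2 hle)]
    have := sub_le_sub_of_lipschitzWith_cis hθ.neg hneg hle
    simp only [Pi.neg_apply] at this
    linarith

theorem exists_continuous_eq_norm_mul_cis {A : Type*} [TopologicalSpace A] [SimplyConnectedSpace A]
    [LocallyPathConnectedSpace A] {F : A → ℂ} (hF : Continuous F) (h₀ : ∀ a, F a ≠ 0) :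
    ∃ ψ : A → ℝ, Continuous ψ ∧ ∀ a, F a = ‖F a‖ * cis (ψ a) := by
  obtain ⟨a₀⟩ : Nonempty A := inferInstance
  obtain ⟨L, ⟨-, hL⟩, -⟩ := Complex.isCoveringMapOn_exp.existsUnique_continuousMap_lifts
    ⟨F, hF⟩ (a₀ := a₀) (Complex.exp_log (h₀ a₀)) h₀
  refine ⟨fun a => (L a).im, by fun_prop, fun a => ?_⟩
  have hexp : Complex.exp (L a) = F a := congrFun hL a
  rw [← hexp]
  exact exp_eq_norm_mul_cis_im _

theorem exists_lipschitzWith_eq_cis {V : ℝ → ℂ} (hV : LipschitzWith 1 V) (hnorm : ∀ t, ‖V t‖ = 1) :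
    ∃ θ : ℝ → ℝ, LipschitzWith 1 θ ∧ ∀ t, V t = cis (θ t) := by
  obtain ⟨θ, hθ, hVθ⟩ := exists_continuous_eq_norm_mul_cis hV.continuous fun t =>
    norm_ne_zero_iff.1 (by simp [hnorm])
  have hVcis : V = fun t => cis (θ t) := funext fun t => by
    simpa only [hnorm, Complex.ofReal_one, one_mul] using hVθ t
  exact ⟨θ, lipschitzWith_of_lipschitzWith_cis hθ (hVcis ▸ hV), congrFun hVcis⟩

/-- The mean of `V` over the interval with end points `p.1` and `p.2`. If `V` is the velocity of a
curve, this is the slope of its secant, extended continuously to the diagonal by the velocity. -/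
noncomputable def meanVelocity (V : ℝ → ℂ) (p : ℝ × ℝ) : ℂ :=
  ∫ τ in (0 : ℝ)..1, V (p.1 + (p.2 - p.1) * τ)

theorem continuous_meanVelocity {V : ℝ → ℂ} (hV : Continuous V) : Continuous (meanVelocity V) :=
  intervalIntegral.continuous_parametric_intervalIntegral_of_continuous' (by fun_prop) 0 1

theorem meanVelocity_self (V : ℝ → ℂ) (a : ℝ) : meanVelocity V (a, a) = V a := by
  simp [meanVelocity]

theorem sub_mul_meanVelocity {Γ V : ℝ → ℂ} (hΓ : ∀ t, HasDerivAt Γ (V t) t) (hV : Continuous V)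
    (a b : ℝ) : ((b - a : ℝ) : ℂ) * meanVelocity V (a, b) = Γ b - Γ a := by
  have h := intervalIntegral.smul_integral_comp_add_mul (a := 0) (b := 1) V (b - a) a
  rw [Complex.real_smul] at h
  rw [meanVelocity, h, intervalIntegral.integral_eq_sub_of_hasDerivAt (fun t _ => hΓ t)
    (hV.intervalIntegrable _ _)]
  ring_nf

namespace HasTangentAngle

variable {Γ : ℝ → ℂ} {θ : ℝ → ℝ} (h : HasTangentAngle Γ θ)

include h

theorem exists_secantAngle {s : ℝ} (hs : 0 ≤ s) (hinj : InjOn Γ (Icc 0 s)) :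
    ∃ ψ : ℝ × ℝ → ℝ, Continuous ψ ∧ (∀ t ∈ Icc 0 s, cis (ψ (t, t)) = cis (θ t)) ∧
      ∀ a ∈ Icc 0 s, ∀ b ∈ Icc 0 s, a < b → Γ b - Γ a = ‖Γ b - Γ a‖ * cis (ψ (a, b)) := by
  have hV : Continuous fun t => cis (θ t) := continuous_cis.comp h.lipschitzWith.continuous
  have hmul := sub_mul_meanVelocity h.hasDerivAt hV
  set M := meanVelocity fun t => cis (θ t) with hM
  have hM₀ : ∀ a ∈ Icc 0 s, ∀ b ∈ Icc 0 s, M (a, b) ≠ 0 := fun a ha b hb h₀ => by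
    rcases eq_or_ne a b with rfl | hab
    · rw [hM, meanVelocity_self] at h₀
      simpa [h₀] using norm_cis (θ a)
    · have := hmul a b
      rw [h₀, mul_zero] at this
      exact hab (hinj ha hb (sub_eq_zero.1 this.symm).symm)
  set c : ℝ → ℝ := fun t => projIcc 0 s hs t with hc
  have hccont : Continuous c := continuous_subtype_val.comp continuous_projIcc
  have hceq : ∀ t ∈ Icc 0 s, c t = t := fun t ht => by rw [hc]; simp [projIcc_of_mem hs ht]
  obtain ⟨ψ, hψ, hMψ⟩ := exists_continuous_eq_norm_mul_cis (A := ℝ × ℝ)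
    (F := fun p => M (c p.1, c p.2)) ((continuous_meanVelocity hV).comp (by fun_prop))
    fun p => hM₀ _ (Subtype.coe_prop _) _ (Subtype.coe_prop _)
  have hMψ' : ∀ a ∈ Icc 0 s, ∀ b ∈ Icc 0 s, M (a, b) = ‖M (a, b)‖ * cis (ψ (a, b)) :=
    fun a ha b hb => by simpa only [hceq a ha, hceq b hb] using hMψ (a, b)
  refine ⟨ψ, hψ, fun t ht => ?_, fun a ha b hb hab => ?_⟩
  · have := hMψ' t ht t ht
    rw [hM, meanVelocity_self, norm_cis] at this
    simpa using this.symm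
  · rw [← hmul, norm_mul, Complex.ofReal_mul, mul_assoc, ← hMψ' a ha b hb, Complex.norm_real,
      Real.norm_of_nonneg (sub_nonneg.2 hab.le)]

theorem abs_sub_le_two_pi_of_injOn {s : ℝ} (hs : 0 < s) (hinj : InjOn Γ (Icc 0 s))
    (hstrip : ∀ t ∈ Icc 0 s, (Γ t).re ∈ Icc (Γ 0).re (Γ s).re) : |θ s - θ 0| ≤ 2 * π := by
  obtain ⟨ψ, hψ, hdiag, hsecant⟩ := h.exists_secantAngle hs.le hinj
  have h0_mem : (0 : ℝ) ∈ Icc 0 s := left_mem_Icc.2 hs.le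
  have hs_mem : s ∈ Icc 0 s := right_mem_Icc.2 hs.le
  have hcos : ∀ a ∈ Icc 0 s, ∀ b ∈ Icc 0 s, a < b → (Γ a).re ≤ (Γ b).re → 0 ≤ cos (ψ (a, b)) := by
    intro a ha b hb hab hre
    have hpos : 0 < ‖Γ b - Γ a‖ := norm_pos_iff.2 (sub_ne_zero.2 fun heq =>
      hab.ne' (hinj hb ha heq))
    have hmul : 0 ≤ ‖Γ b - Γ a‖ * cos (ψ (a, b)) := by
      rw [← cis_re, ← Complex.re_ofReal_mul, ← hsecant a ha b hb hab, Complex.sub_re]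
      exact sub_nonneg.2 hre
    exact nonneg_of_mul_nonneg_right hmul hpos
  have hleg₁ : ∀ t ∈ Icc 0 s, 0 ≤ cos (ψ (0, t)) := by
    have hclosed : IsClosed {t | 0 ≤ cos (ψ (0, t))} :=
      isClosed_le continuous_const (by fun_prop)
    rw [← closure_Ioc hs.ne]
    exact closure_minimal (fun t ht => hcos 0 h0_mem t (Ioc_subset_Icc_self ht) ht.1
      (hstrip t (Ioc_subset_Icc_self ht)).1) hclosed
  have hleg₂ : ∀ t ∈ Icc 0 s, 0 ≤ cos (ψ (t, s)) := by
    have hclosed : IsClosed {t | 0 ≤ cos (ψ (t, s))} :=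
      isClosed_le continuous_const (by fun_prop)
    rw [← closure_Ico hs.ne]
    exact closure_minimal (fun t ht => hcos t (Ico_subset_Icc_self ht) s hs_mem ht.2
      (hstrip t (Ico_subset_Icc_self ht)).2) hclosed
  have hvar₁ := abs_sub_le_pi_of_cos_nonneg (φ := fun t => ψ (0, t)) isPreconnected_Icc
    (by fun_prop) hleg₁ h0_mem hs_mem
  have hvar₂ := abs_sub_le_pi_of_cos_nonneg (φ := fun t => ψ (t, s)) isPreconnected_Icc
    (by fun_prop) hleg₂ h0_mem hs_mem
  have hθ := sub_eq_sub_of_cis_eq (ψ := fun t => ψ (t, t)) isPreconnected_Icc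
    h.lipschitzWith.continuous.continuousOn (by fun_prop) (fun t ht => (hdiag t ht).symm)
    h0_mem hs_mem
  rw [hθ, ← sub_add_sub_cancel _ (ψ (0, s))]
  exact (abs_add_le _ _).trans (by linarith)

end HasTangentAngle

/-! ### Bounded curvature paths -/

theorem lipschitzOnWith_Icc_union {α : Type*} [PseudoMetricSpace α] {f : ℝ → α} {K : NNReal}
    {a b c : ℝ} (hab : LipschitzOnWith K f (Icc a b)) (hbc : LipschitzOnWith K f (Icc b c)) :
    LipschitzOnWith K f (Icc a c) := by
  have hle : ∀ t ∈ Icc a c, ∀ t' ∈ Icc a c, t ≤ t' → dist (f t) (f t') ≤ K * dist t t' := by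
    intro t ht t' ht' htt'
    rcases le_total t' b with htb' | hbt'
    · exact hab.dist_le_mul t ⟨ht.1, htt'.trans htb'⟩ t' ⟨ht'.1, htb'⟩
    rcases le_total b t with hbt | htb
    · exact hbc.dist_le_mul t ⟨hbt, ht.2⟩ t' ⟨hbt', ht'.2⟩
    calc dist (f t) (f t') ≤ dist (f t) (f b) + dist (f b) (f t') := dist_triangle _ _ _
      _ ≤ K * dist t b + K * dist b t' :=
        add_le_add (hab.dist_le_mul t ⟨ht.1, htb⟩ b ⟨ht.1.trans htb, le_rfl⟩)
          (hbc.dist_le_mul b ⟨le_rfl, hbt'.trans ht'.2⟩ t' ⟨hbt', ht'.2⟩)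
      _ = K * dist t t' := by
        rw [Real.dist_eq, Real.dist_eq, Real.dist_eq, abs_of_nonpos (sub_nonpos.2 htb),
          abs_of_nonpos (sub_nonpos.2 hbt'), abs_of_nonpos (sub_nonpos.2 htt')]
        ring
  refine LipschitzOnWith.of_dist_le_mul fun t ht t' ht' => ?_
  rcases le_total t t' with htt' | htt'
  · exact hle t ht t' ht' htt'
  · rw [dist_comm (f t), dist_comm t]
    exact hle t' ht' t ht htt'

theorem lipschitzOnWith_Icc_of_forall_lt {α : Type*} [PseudoMetricSpace α] {f : ℝ → α} {K : NNReal}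
    {p : ℕ → ℝ} {n : ℕ} (h : ∀ i < n, LipschitzOnWith K f (Icc (p i) (p (i + 1)))) :
    LipschitzOnWith K f (Icc (p 0) (p n)) := by
  induction n with
  | zero => exact Icc_self (p 0) ▸ LipschitzOnWith.of_dist_le_mul (by simp)
  | succ n ih => exact lipschitzOnWith_Icc_union (ih fun i hi => h i (by lia)) (h n (by lia))

namespace IsBoundedCurvaturePath

variable {x y : UnitTangent} {s : ℝ} {γ : ℝ → ℂ} (h : IsBoundedCurvaturePath x y s γ)

include h

theorem continuousOn_velocity : ContinuousOn (velocity s γ) (Icc 0 s) :=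
  h.c1.continuousOn_derivWithin (uniqueDiffOn_Icc h.pos) le_rfl

theorem hasDerivAt {t : ℝ} (ht : t ∈ Ioo 0 s) : HasDerivAt γ (velocity s γ t) t :=
  ((h.c1.differentiableOn one_ne_zero t (Ioo_subset_Icc_self ht)).hasDerivWithinAt).hasDerivAt
    (Icc_mem_nhds ht.1 ht.2)

theorem norm_deriv_velocity_le {t : ℝ} (ht : t ∈ Ioo 0 s)
    (hdiff : DifferentiableAt ℝ (velocity s γ) t) : ‖deriv (velocity s γ) t‖ ≤ 1 := by
  rw [← derivWithin_of_mem_nhds (Icc_mem_nhds ht.1 ht.2)]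
  exact h.curvature t (Ioo_subset_Icc_self ht) hdiff.differentiableWithinAt

theorem lipschitzOnWith_velocity_of_contDiffOn {a b : ℝ} (hab : a < b)
    (hsub : Icc a b ⊆ Icc 0 s) (hγ : ContDiffOn ℝ 2 γ (Icc a b)) :
    LipschitzOnWith 1 (velocity s γ) (Icc a b) := by
  have hIoo : Ioo a b ⊆ Ioo 0 s := fun t ht =>
    ⟨(hsub (left_mem_Icc.2 hab.le)).1.trans_lt ht.1,
      ht.2.trans_le (hsub (right_mem_Icc.2 hab.le)).2⟩
  have hderiv : DifferentiableOn ℝ (deriv γ) (Ioo a b) :=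
    ((hγ.mono Ioo_subset_Icc_self).deriv_of_isOpen (m := 1) isOpen_Ioo
      (by norm_num)).differentiableOn one_ne_zero
  have hdiff : ∀ t ∈ Ioo a b, DifferentiableAt ℝ (velocity s γ) t := fun t ht =>
    ((hderiv.congr fun u hu => (h.hasDerivAt (hIoo hu)).deriv.symm) t ht).differentiableAt
      (isOpen_Ioo.mem_nhds ht)
  have hlip : LipschitzOnWith 1 (velocity s γ) (Ioo a b) :=
    (convex_Ioo a b).lipschitzOnWith_of_nnnorm_deriv_le hdiff fun t ht =>
      h.norm_deriv_velocity_le (hIoo ht) (hdiff t ht)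
  rw [← closure_Ioo hab.ne] at hsub ⊢
  exact hlip.closure (h.continuousOn_velocity.mono hsub)

theorem lipschitzOnWith_velocity : LipschitzOnWith 1 (velocity s γ) (Icc 0 s) := by
  obtain ⟨n, p, hp0, hpn, hp⟩ := h.piecewise_c2
  have hmono : MonotoneOn p (Iic n) :=
    monotoneOn_of_le_add_one ordConnected_Iic fun i _ _ hi => (hp i hi).1.le
  have hsub : ∀ i < n, Icc (p i) (p (i + 1)) ⊆ Icc 0 s := fun i hi =>
    Icc_subset_Icc (hp0 ▸ hmono (mem_Iic.2 n.zero_le) hi.le i.zero_le)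
      (hpn ▸ hmono hi self_mem_Iic hi)
  have hlip : LipschitzOnWith 1 (velocity s γ) (Icc (p 0) (p n)) :=
    lipschitzOnWith_Icc_of_forall_lt fun i hi =>
      h.lipschitzOnWith_velocity_of_contDiffOn (hp i hi).1 (hsub i hi) (hp i hi).2
  rwa [hp0, hpn] at hlip

theorem exists_hasTangentAngle : ∃ Γ : ℝ → ℂ, ∃ θ : ℝ → ℝ, HasTangentAngle Γ θ ∧
    EqOn Γ γ (Icc 0 s) ∧ ∀ t ∈ Icc 0 s, velocity s γ t = cis (θ t) := by
  set V : ℝ → ℂ := IccExtend h.pos.le ((Icc 0 s).domRestrict (velocity s γ))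
  have hVeq : ∀ t ∈ Icc 0 s, V t = velocity s γ t := fun t ht => IccExtend_of_mem _ _ ht
  have hVlip : LipschitzWith 1 V := by
    rw [← one_mul (1 : NNReal)]
    exact h.lipschitzOnWith_velocity.to_restrict.comp (LipschitzWith.projIcc h.pos.le)
  obtain ⟨θ, hθ, hVθ⟩ := exists_lipschitzWith_eq_cis hVlip fun t =>
    h.unit_speed _ (Subtype.coe_prop _)
  refine ⟨fun t => γ 0 + ∫ u in (0 : ℝ)..t, V u, θ, ⟨fun t => ?_, hθ⟩, fun t ht => ?_,
    fun t ht => (hVeq t ht).symm.trans (hVθ t)⟩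
  · exact hVθ t ▸ (hVlip.continuous.integral_hasStrictDerivAt 0 t).hasDerivAt.const_add _
  · have hFTC := intervalIntegral.integral_eq_sub_of_hasDerivAt_of_le ht.1
      (h.c1.continuousOn.mono (Icc_subset_Icc_right ht.2))
      (fun u hu => by
        have hu' : u ∈ Ioo 0 s := ⟨hu.1, hu.2.trans_le ht.2⟩
        rw [hVeq u (Ioo_subset_Icc_self hu')]
        exact h.hasDerivAt hu')
      (hVlip.continuous.intervalIntegrable 0 t)
    simp only [hFTC, add_sub_cancel]

theorem hasParallelTangents_of_diam_le (hdiam : Metric.diam (γ '' Icc 0 s) ≤ 4) (hs : 297 ≤ s) :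
    HasParallelTangents s γ := by
  obtain ⟨Γ, θ, hΓ, hΓγ, hvel⟩ := h.exists_hasTangentAngle
  have hbdd : Bornology.IsBounded (γ '' Icc 0 s) :=
    (isCompact_Icc.image_of_continuousOn h.c1.continuousOn).isBounded
  have hdist : ∀ t ∈ Icc 0 s, ∀ t' ∈ Icc 0 s, dist (Γ t) (Γ t') ≤ 4 := fun t ht t' ht' => by
    rw [hΓγ ht, hΓγ ht']
    exact (Metric.dist_le_diam_of_mem hbdd (mem_image_of_mem γ ht)
      (mem_image_of_mem γ ht')).trans hdiam
  have hθ := hΓ.lipschitzWith.continuous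
  -- `297 = (8 * 4 + 1) * (2 * 4 + 1)`
  rcases hΓ.risesOn_pi_or_neg h.pos.le hdist (by linarith) with hrise | hfall
  · obtain ⟨t, ht, t', ht', htt', hθt⟩ := hrise.exists_eq_add pi_pos hθ
    exact ⟨t, ht, t', ht', htt', by rw [hvel t ht, hvel t' ht', hθt, cis_add_pi]⟩
  · obtain ⟨t, ht, t', ht', htt', hθt⟩ := hfall.exists_eq_add pi_pos hθ.neg
    have hθt' : θ t = θ t' + π := by simp only [Pi.neg_apply] at hθt; linarith
    exact ⟨t, ht, t', ht', htt', by rw [hvel t ht, hvel t' ht', hθt', cis_add_pi, neg_neg]⟩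

end IsBoundedCurvaturePath

/-! ### Paths formed by three arcs -/

theorem norm_cis_add_cis_sub_cis_sq (a b c : ℝ) :
    ‖cis a + cis b - cis c‖ ^ 2 = 1 + 4 * cos ((b - a) / 2) *
      (cos ((b - a) / 2) - cos ((a + b - 2 * c) / 2)) := by
  have hdouble : cos (b - a) = 2 * cos ((b - a) / 2) ^ 2 - 1 := by
    rw [← cos_two_mul, mul_div_cancel₀ _ two_ne_zero]
  have hsum : cos (c - a) + cos (b - c) =
      2 * cos ((b - a) / 2) * cos ((a + b - 2 * c) / 2) := by
    rw [cos_add_cos, ← cos_neg ((c - a - (b - c)) / 2)]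
    ring_nf
  simp only [cos_sub] at hdouble hsum
  rw [Complex.sq_norm, Complex.normSq_apply]
  simp only [Complex.sub_re, Complex.add_re, Complex.sub_im, Complex.add_im, cis_re, cis_im]
  linear_combination sin_sq_add_cos_sq a + sin_sq_add_cos_sq b + sin_sq_add_cos_sq c +
    2 * hdouble - 2 * hsum

theorem norm_cis_add_cis_sub_cis_lt_one_iff {a b c : ℝ} (hac : a < c) (hcb : c < b)
    (hca : c - a < π) (hbc : b - c < π) : ‖cis a + cis b - cis c‖ < 1 ↔ b - a < π := by
  have hcos : cos ((b - a) / 2) < cos ((a + b - 2 * c) / 2) := by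
    rw [← cos_abs ((a + b - 2 * c) / 2)]
    refine cos_lt_cos_of_nonneg_of_le_pi (abs_nonneg _) (by linarith) ?_
    rw [abs_lt]
    constructor <;> linarith
  rw [← sq_lt_one_iff₀ (norm_nonneg _), norm_cis_add_cis_sub_cis_sq]
  refine ⟨fun h => ?_, fun h => ?_⟩
  · by_contra! hc
    have := cos_nonpos_of_pi_div_two_le_of_le (x := (b - a) / 2) (by linarith) (by linarith)
    nlinarith
  · have := cos_pos_of_mem_Ioo (x := (b - a) / 2) ⟨by linarith, by linarith⟩
    nlinarith

theorem norm_cis_sub_cis_lt_two {a b : ℝ} (h : |a - b| < π) : ‖cis a - cis b‖ < 2 := by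
  have hsq : ‖cis a - cis b‖ ^ 2 = 2 - 2 * cos (a - b) := by
    rw [Complex.sq_norm, Complex.normSq_apply]
    simp only [Complex.sub_re, Complex.sub_im, cis_re, cis_im, cos_sub]
    linear_combination sin_sq_add_cos_sq a + sin_sq_add_cos_sq b
  have hcos : -1 < cos (a - b) := by
    rw [← cos_abs, ← cos_pi]
    exact cos_lt_cos_of_nonneg_of_le_pi (abs_nonneg _) le_rfl h
  nlinarith [norm_nonneg (cis a - cis b)]

theorem norm_cis_add_cis_sub_cis_sub_cis_lt_two {a b c d : ℝ} (hc : c ∈ uIcc a b)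
    (hab : |a - b| < π) (had : |a - d| < π) (hbd : |b - d| < π) :
    ‖cis a + cis b - cis c - cis d‖ < 2 := by
  wlog hle : a ≤ b generalizing a b
  · rw [add_comm (cis a)]
    exact this (uIcc_comm a b ▸ hc) (abs_sub_comm a b ▸ hab) hbd had (not_le.1 hle).le
  rw [uIcc_of_le hle] at hc
  rcases hc.1.eq_or_lt with rfl | hac
  · rw [add_sub_cancel_left]
    exact norm_cis_sub_cis_lt_two hbd
  rcases hc.2.eq_or_lt with rfl | hcb
  · rw [add_sub_cancel_right]
    exact norm_cis_sub_cis_lt_two had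
  rw [abs_lt] at hab
  have hlt := (norm_cis_add_cis_sub_cis_lt_one_iff hac hcb (by linarith) (by linarith)).2
    (by linarith)
  calc ‖cis a + cis b - cis c - cis d‖ ≤ ‖cis a + cis b - cis c‖ + ‖cis d‖ := norm_sub_le _ _
    _ < 2 := by rw [norm_cis]; linarith

theorem add_units_mul_mem_uIcc (φ : ℝ) (ε : ℤˣ) {r t r' : ℝ} (h : t ∈ Icc r r') :
    φ + (ε : ℤ) * t ∈ uIcc (φ + (ε : ℤ) * r) (φ + (ε : ℤ) * r') := by
  rcases Int.units_eq_one_or ε with rfl | rfl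
  · exact mem_uIcc.2 (.inl ⟨by simpa using h.1, by simpa using h.2⟩)
  · exact mem_uIcc.2 (.inr ⟨by simpa [← sub_eq_add_neg] using sub_le_sub_left h.2 φ,
      by simpa [← sub_eq_add_neg] using sub_le_sub_left h.1 φ⟩)

/-- The angles by which the path `threeArcs u ε a` has turned in the direction `ε` at the ends of
its arcs. -/
def turning (a : Fin 3 → ℝ) : Fin 4 → ℝ :=
  ![0, a 0, a 0 - a 1, a 0 - a 1 + a 2]

theorem forall_turning_iff {a : Fin 3 → ℝ} {p : ℝ → Prop} :
    (∀ i, p (turning a i)) ↔ p 0 ∧ p (a 0) ∧ p (a 0 - a 1) ∧ p (a 0 - a 1 + a 2) := by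
  simp [turning, Fin.forall_fin_succ]

namespace UnitTangent

theorem dir_eq_cis_arg (u : UnitTangent) : u.dir = cis u.dir.arg := by
  simpa [u.norm_dir, cis] using (Complex.norm_mul_exp_arg_mul_I u.dir).symm

theorem turn_zero (u : UnitTangent) (ε : ℤˣ) : u.turn ε 0 = u := by
  obtain ⟨p, X, hX⟩ := u
  simp [turn]

theorem continuous_base_turn (u : UnitTangent) (ε : ℤˣ) :
    Continuous fun t => (u.turn ε t).base := by
  unfold turn
  fun_prop

theorem threeArcs_of_lt (u : UnitTangent) (ε : ℤˣ) {a : Fin 3 → ℝ} {t : ℝ} (h : 0 ≤ a 1)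
    (ht : a 0 + a 1 < t) :
    u.threeArcs ε a t = ((u.turn ε (a 0)).turn (-ε) (a 1)).turn ε (t - a 0 - a 1) := by
  rw [threeArcs, if_neg (by linarith), if_neg ht.not_ge]

theorem isCompact_threeArcsTrace (u : UnitTangent) (ε : ℤˣ) {a : Fin 3 → ℝ} (h : 0 ≤ a 1) :
    IsCompact (u.threeArcsTrace ε a) := by
  refine isCompact_Icc.image ?_
  simp only [threeArcs, apply_ite base]
  refine Continuous.if_le (continuous_base_turn _ _) (Continuous.if_le
    ((continuous_base_turn _ _).comp (by fun_prop)) ((continuous_base_turn _ _).comp (by fun_prop))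
    continuous_id continuous_const ?_) continuous_id continuous_const ?_
  · rintro t rfl
    simp [turn_zero]
  · rintro t rfl
    simp [turn_zero, h]

section

variable {u : UnitTangent} {φ : ℝ} (hu : u.dir = cis φ)

include hu

theorem dir_turn (ε : ℤˣ) (t : ℝ) : (u.turn ε t).dir = cis (φ + (ε : ℤ) * t) := by
  rw [cis_add, ← hu]
  rfl

theorem base_turn (ε : ℤˣ) (t : ℝ) : (u.turn ε t).base =
    u.base + (ε : ℤ) * Complex.I * (cis φ - cis (φ + (ε : ℤ) * t)) := by
  rw [cis_add, ← hu, turn, cis]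
  ring

theorem base_turn_turn (ε : ℤˣ) (t₀ t₁ : ℝ) : ((u.turn ε t₀).turn (-ε) t₁).base =
    u.base + (ε : ℤ) * Complex.I *
      (cis φ - 2 * cis (φ + (ε : ℤ) * t₀) + cis (φ + (ε : ℤ) * (t₀ - t₁))) := by
  rw [base_turn (dir_turn hu ε t₀), base_turn hu]
  push_cast
  ring_nf

theorem dir_turn_turn (ε : ℤˣ) (t₀ t₁ : ℝ) :
    ((u.turn ε t₀).turn (-ε) t₁).dir = cis (φ + (ε : ℤ) * (t₀ - t₁)) := by
  rw [dir_turn (dir_turn hu ε t₀)]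
  push_cast
  ring_nf

theorem base_turn_turn_turn (ε : ℤˣ) (t₀ t₁ t₂ : ℝ) :
    (((u.turn ε t₀).turn (-ε) t₁).turn ε t₂).base =
      u.base + (ε : ℤ) * Complex.I * (cis φ - 2 * cis (φ + (ε : ℤ) * t₀) +
        2 * cis (φ + (ε : ℤ) * (t₀ - t₁)) - cis (φ + (ε : ℤ) * (t₀ - t₁ + t₂))) := by
  rw [base_turn (dir_turn_turn hu ε t₀ t₁), base_turn_turn hu]
  ring_nf

theorem exists_of_mem_threeArcsTrace {ε : ℤˣ} {a : Fin 3 → ℝ} {z : ℂ} (h : 0 ≤ a 1)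
    (hz : z ∈ u.threeArcsTrace ε a) :
    (∃ t ∈ Icc 0 (a 0), z = u.base + (ε : ℤ) * Complex.I * (cis φ - cis (φ + (ε : ℤ) * t))) ∨
    (∃ t ∈ Icc (a 0 - a 1) (a 0), z = u.base + (ε : ℤ) * Complex.I *
      (cis φ - 2 * cis (φ + (ε : ℤ) * a 0) + cis (φ + (ε : ℤ) * t))) ∨
    ∃ t ∈ Icc (a 0 - a 1) (a 0 - a 1 + a 2), z = u.base + (ε : ℤ) * Complex.I *
      (cis φ - 2 * cis (φ + (ε : ℤ) * a 0) + 2 * cis (φ + (ε : ℤ) * (a 0 - a 1)) -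
        cis (φ + (ε : ℤ) * t)) := by
  obtain ⟨t, ht, rfl⟩ := hz
  rcases le_or_gt t (a 0) with h₀ | h₀
  · exact .inl ⟨t, ⟨ht.1, h₀⟩, by simp only [threeArcs, if_pos h₀, base_turn hu]⟩
  rcases le_or_gt t (a 0 + a 1) with h₁ | h₁
  · refine .inr (.inl ⟨a 0 - (t - a 0), ⟨by linarith, by linarith⟩, ?_⟩)
    simp only [threeArcs, if_neg h₀.not_ge, if_pos h₁, base_turn_turn hu]
  · refine .inr (.inr ⟨a 0 - a 1 + (t - a 0 - a 1), ⟨by linarith, by linarith [ht.2]⟩, ?_⟩)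
    simp only [threeArcs_of_lt u ε h h₁, base_turn_turn_turn hu]

end

end UnitTangent

section Closing

variable {φ : ℝ} {a b : Fin 3 → ℝ} (ha : ∀ i, a i ∈ Ioo 0 π) (hb : ∀ i, b i ∈ Ioo 0 π)
  (hdir : cis (φ + (a 0 - a 1 + a 2)) = cis (φ - (b 0 - b 1 + b 2)))
  (hclose : cis φ + cis (φ + (a 0 - a 1)) + cis (φ - (b 0 - b 1)) =
    cis (φ + a 0) + cis (φ - b 0) + cis (φ + (a 0 - a 1 + a 2)))

include ha hb hclose

theorem turning_add_turning_ne_two_pi_of_closing (h₀ : π ≤ a 0 + b 0) (h₂ : π ≤ a 2 + b 2) :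
    a 0 - a 1 + a 2 + (b 0 - b 1 + b 2) ≠ 2 * π := by
  intro hturn
  have := ha 0; have := ha 1; have := ha 2
  have := hb 0; have := hb 1; have := hb 2
  simp only [mem_Ioo] at *
  set lo := min (a 0 - π) (-(b 0 - b 1)) with hlo
  set hi := max (π - b 0) (a 0 - a 1) with hhi
  have hlohi : hi ≤ lo + π := by
    simp only [hlo, hhi, max_le_iff, ← min_add_add_right, le_min_iff]
    refine ⟨⟨?_, ?_⟩, ?_, ?_⟩ <;> linarith
  have hlo₁ : lo ≤ a 0 - π := min_le_left _ _
  have hlo₂ : lo ≤ -(b 0 - b 1) := min_le_right _ _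
  have hhi₁ : π - b 0 ≤ hi := le_max_left _ _
  have hhi₂ : a 0 - a 1 ≤ hi := le_max_right _ _
  set μ := (lo + hi) / 2 with hμ
  have hcos : ∀ t ∈ Icc lo hi, 0 ≤ cos (t - μ) := fun t ht =>
    cos_nonneg_of_mem_Icc ⟨by linarith [ht.1], by linarith [ht.2]⟩
  have hcos₀ : 0 < cos (0 - μ) := cos_pos_of_mem_Ioo ⟨by linarith, by linarith⟩
  have hcos_a₁ := hcos (a 0 - π) ⟨hlo₁, by linarith⟩
  have hcos_a₂ := hcos (a 0 - a 1) ⟨by linarith, hhi₂⟩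
  have hcos_a₃ := hcos (a 0 - a 1 + a 2 - π) ⟨by linarith, by linarith⟩
  have hcos_b₁ := hcos (π - b 0) ⟨by linarith, hhi₁⟩
  have hcos_b₂ := hcos (-(b 0 - b 1)) ⟨hlo₂, by linarith⟩
  rw [sub_right_comm, cos_sub_pi] at hcos_a₁ hcos_a₃
  rw [sub_sub, ← neg_sub, cos_neg, cos_sub_pi, ← cos_neg] at hcos_b₁
  have hproj := congrArg (fun z => (z * cis (-(φ + μ))).re) hclose
  simp only [add_mul, ← cis_add, Complex.add_re, cis_re] at hproj
  ring_nf at hproj hcos₀ hcos_a₁ hcos_a₂ hcos_a₃ hcos_b₁ hcos_b₂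
  linarith

include hdir

theorem add_lt_pi_iff_add_lt_pi_of_closing : a 0 + b 0 < π ↔ a 2 + b 2 < π := by
  have hlast : cis (φ - (b 0 - b 1)) = cis (φ + (a 0 - a 1 + a 2) + b 2) := by
    rw [cis_add _ (b 2), hdir, ← cis_add]
    ring_nf
  have hnorm : cis (φ - b 0) + cis (φ + a 0) - cis φ = cis (φ + (a 0 - a 1)) +
      cis (φ + (a 0 - a 1 + a 2) + b 2) - cis (φ + (a 0 - a 1 + a 2)) := by
    rw [← hlast]
    linear_combination -hclose
  have hstart := norm_cis_add_cis_sub_cis_lt_one_iff (a := φ - b 0) (b := φ + a 0) (c := φ)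
    (by linarith [(hb 0).1]) (by linarith [(ha 0).1]) (by linarith [(hb 0).2])
    (by linarith [(ha 0).2])
  have hend := norm_cis_add_cis_sub_cis_lt_one_iff (a := φ + (a 0 - a 1))
    (b := φ + (a 0 - a 1 + a 2) + b 2) (c := φ + (a 0 - a 1 + a 2))
    (by linarith [(ha 2).1]) (by linarith [(hb 2).1]) (by linarith [(ha 2).2])
    (by linarith [(hb 2).2])
  rw [hnorm, hend] at hstart
  constructor <;> intro h
  · linarith [hstart.2 (by linarith)]
  · linarith [hstart.1 (by linarith)]

theorem add_lt_pi_and_turning_add_turning_eq_zero_of_closing :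
    a 0 + b 0 < π ∧ a 2 + b 2 < π ∧ a 0 - a 1 + a 2 + (b 0 - b 1 + b 2) = 0 := by
  have hiff := add_lt_pi_iff_add_lt_pi_of_closing ha hb hdir hclose
  obtain ⟨k, hk⟩ := Circle.exp_eq_exp.1 (Circle.ext hdir)
  have := pi_pos
  have := ha 0; have := ha 1; have := ha 2
  have := hb 0; have := hb 1; have := hb 2
  simp only [mem_Ioo] at *
  have hlt : a 0 + b 0 < π := by
    by_contra hge
    have hge₂ := mt hiff.2 hge
    have hk₀ : 0 < (k : ℝ) := by nlinarith
    have hk₂ : (k : ℝ) < 2 := by nlinarith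
    have hk₁ : k = 1 := by norm_cast at hk₀ hk₂; lia
    refine turning_add_turning_ne_two_pi_of_closing ha hb hclose (not_lt.1 hge) (not_lt.1 hge₂) ?_
    rw [hk₁, Int.cast_one] at hk
    linarith
  refine ⟨hlt, hiff.1 hlt, ?_⟩
  have hk₀ : k = 0 := by
    have := hiff.1 hlt
    have hk₀ : -1 < (k : ℝ) := by nlinarith
    have hk₁ : (k : ℝ) < 1 := by nlinarith
    norm_cast at hk₀ hk₁
    lia
  rw [hk₀, Int.cast_zero] at hk
  linarith

theorem exists_forall_abs_turning_sub_lt_of_closing : ∃ μ : ℝ, ∀ i,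
    |φ + turning a i - μ| < π / 2 ∧ |φ - turning b i - μ| < π / 2 := by
  obtain ⟨h₀, h₂, hturn⟩ :=
    add_lt_pi_and_turning_add_turning_eq_zero_of_closing ha hb hdir hclose
  have := ha 0; have := ha 1; have := ha 2
  have := hb 0; have := hb 1; have := hb 2
  simp only [mem_Ioo] at *
  set lo := min (-b 0) (a 0 - a 1) with hlo
  set hi := max (a 0) (-(b 0 - b 1)) with hhi
  have hlohi : hi < lo + π := by
    simp only [hlo, hhi, max_lt_iff, ← min_add_add_right, lt_min_iff]
    refine ⟨⟨?_, ?_⟩, ?_, ?_⟩ <;> linarith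
  have hlo₁ : lo ≤ -b 0 := min_le_left _ _
  have hlo₂ : lo ≤ a 0 - a 1 := min_le_right _ _
  have hhi₁ : a 0 ≤ hi := le_max_left _ _
  have hhi₂ : -(b 0 - b 1) ≤ hi := le_max_right _ _
  have hmem : ∀ t ∈ Icc lo hi, |φ + t - (φ + (lo + hi) / 2)| < π / 2 := fun t ht => by
    rw [abs_lt]
    constructor <;> linarith [ht.1, ht.2]
  have hmem_a : ∀ i, turning a i ∈ Icc lo hi := forall_turning_iff.2
    ⟨⟨by linarith, by linarith⟩, ⟨by linarith, hhi₁⟩, ⟨hlo₂, by linarith⟩, by linarith, by linarith⟩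
  have hmem_b : ∀ i, -turning b i ∈ Icc lo hi := (forall_turning_iff (p := fun t => -t ∈ _)).2
    ⟨⟨by linarith, by linarith⟩, ⟨hlo₁, by linarith⟩, ⟨by linarith, hhi₂⟩, by linarith, by linarith⟩
  exact ⟨φ + (lo + hi) / 2, fun i => ⟨hmem _ (hmem_a i), hmem _ (hmem_b i)⟩⟩

end Closing

theorem closure_boundedComplement_subset {C K : Set ℂ} (hC : C.Nonempty) (hK : Convex ℝ K)
    (hKc : IsClosed K) (hCK : C ⊆ K) : closure (boundedComplement C) ⊆ K := by
  refine closure_minimal (fun z hz => ?_) hKc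
  by_contra hzK
  obtain ⟨f, c, hfK, hfz⟩ := geometric_hahn_banach_closed_point hK hKc hzK
  obtain ⟨w, hw⟩ := hC
  have hd : 0 < f (z - w) := by linarith [hfK w (hCK hw), map_sub f z w]
  have hhalf : {v | c < f v} ⊆ connectedComponentIn Cᶜ z :=
    (convex_halfSpace_gt f.toLinearMap.isLinear c).isPreconnected.subset_connectedComponentIn
      hfz fun v hv hvC => hv.not_gt (hfK v (hCK hvC))
  obtain ⟨M, hM⟩ := (f.lipschitz.isBounded_image (hz.2.subset hhalf)).bddAbove
  have hM : ∀ v, c < f v → f v ≤ M := fun v hv => hM (mem_image_of_mem f hv)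
  have hray : f (z + ((M - f z + 1) / f (z - w)) • (z - w)) = M + 1 := by
    rw [map_add, map_smul, smul_eq_mul, div_mul_cancel₀ _ hd.ne']
    ring
  linarith [hM _ (by linarith [hM z hfz] : c < f (z + ((M - f z + 1) / f (z - w)) • (z - w)))]

theorem convex_setOf_re_mul_mem_Icc (w : ℂ) (m M : ℝ) :
    Convex ℝ {z : ℂ | (w * z).re ∈ Icc m M} :=
  (convex_Icc m M).linear_preimage (Complex.reLm ∘ₗ LinearMap.mulLeft ℝ w)

theorem isClosed_setOf_re_mul_mem_Icc (w : ℂ) (m M : ℝ) :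
    IsClosed {z : ℂ | (w * z).re ∈ Icc m M} :=
  isClosed_Icc.preimage (by fun_prop)

theorem abs_add_units_mul_sub_lt {φ μ r t r' c : ℝ} {ε : ℤˣ} (h : t ∈ Icc r r')
    (hr : |φ + (ε : ℤ) * r - μ| < c) (hr' : |φ + (ε : ℤ) * r' - μ| < c) :
    |φ + (ε : ℤ) * t - μ| < c := by
  have hconv := (convex_ball μ c).ordConnected.uIcc_subset (x := φ + (ε : ℤ) * r)
    (y := φ + (ε : ℤ) * r') (by simpa [dist_eq_norm] using hr) (by simpa [dist_eq_norm] using hr')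
  simpa [dist_eq_norm] using hconv (add_units_mul_mem_uIcc φ ε h)

theorem monotoneOn_units_mul_sin {φ μ r r' : ℝ} {ε : ℤˣ} (hr : |φ + (ε : ℤ) * r - μ| < π / 2)
    (hr' : |φ + (ε : ℤ) * r' - μ| < π / 2) :
    MonotoneOn (fun t => (ε : ℤ) * sin (φ + (ε : ℤ) * t - μ)) (Icc r r') := by
  intro t ht t' ht' h
  have hsin := Ioo_subset_Icc_self (abs_lt.1 (abs_add_units_mul_sub_lt ht hr hr'))
  have hsin' := Ioo_subset_Icc_self (abs_lt.1 (abs_add_units_mul_sub_lt ht' hr hr'))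
  rcases Int.units_eq_one_or ε with rfl | rfl
  · simpa using monotoneOn_sin hsin hsin' (by simpa using h)
  · simpa using monotoneOn_sin hsin' hsin (by simp; linarith)

theorem re_cis_neg_mul_units_mul_I_mul_cis (ε : ℤˣ) (μ τ : ℝ) :
    (cis (-μ) * ((ε : ℤ) * Complex.I * cis τ)).re = -((ε : ℤ) * sin (τ - μ)) := by
  rw [sub_eq_neg_add, ← cis_im, cis_add, mul_left_comm, mul_assoc]
  rw [← Complex.ofReal_intCast, Complex.re_ofReal_mul, Complex.I_mul_re]
  exact mul_neg _ _

namespace UnitTangent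

theorem threeArcsTrace_nonempty (u : UnitTangent) (ε : ℤˣ) {a : Fin 3 → ℝ} (ha : ∀ i, 0 ≤ a i) :
    (u.threeArcsTrace ε a).Nonempty :=
  (nonempty_Icc.2 (by linarith [ha 0, ha 1, ha 2])).image _

section

variable {u : UnitTangent} {φ : ℝ} (hu : u.dir = cis φ) {ε : ℤˣ} {a : Fin 3 → ℝ}
  (ha : ∀ i, 0 < a i)

include hu ha

theorem dir_threeArcs_sum : (u.threeArcs ε a (a 0 + a 1 + a 2)).dir =
    cis (φ + (ε : ℤ) * (a 0 - a 1 + a 2)) := by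
  rw [threeArcs_of_lt u ε (ha 1).le (by linarith [ha 2]), dir_turn (dir_turn_turn hu ε _ _)]
  ring_nf

theorem base_threeArcs_sum : (u.threeArcs ε a (a 0 + a 1 + a 2)).base =
    u.base + (ε : ℤ) * Complex.I * (cis φ - 2 * cis (φ + (ε : ℤ) * a 0) +
      2 * cis (φ + (ε : ℤ) * (a 0 - a 1)) - cis (φ + (ε : ℤ) * (a 0 - a 1 + a 2))) := by
  rw [threeArcs_of_lt u ε (ha 1).le (by linarith [ha 2]), base_turn_turn_turn hu]
  ring_nf

variable {μ : ℝ} (hμ : ∀ i, |φ + (ε : ℤ) * turning a i - μ| < π / 2)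

include hμ

theorem re_cis_neg_mul_mem_Icc_of_mem_threeArcsTrace {z : ℂ} (hz : z ∈ u.threeArcsTrace ε a) :
    (cis (-μ) * z).re ∈ Icc (cis (-μ) * u.base).re
      (cis (-μ) * (u.threeArcs ε a (a 0 + a 1 + a 2)).base).re := by
  set g := fun t => (ε : ℤ) * sin (φ + (ε : ℤ) * t - μ)
  have hproj : ∀ t, (cis (-μ) * ((ε : ℤ) * Complex.I * cis (φ + (ε : ℤ) * t))).re = -g t :=
    fun t => re_cis_neg_mul_units_mul_I_mul_cis ε μ _
  have hproj₀ : (cis (-μ) * ((ε : ℤ) * Complex.I * cis φ)).re = -g 0 := by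
    rw [← hproj, mul_zero, add_zero]
  have hmaps₁ : MapsTo g (Icc 0 (a 0)) (Icc (g 0) (g (a 0))) :=
    (monotoneOn_units_mul_sin (hμ 0) (hμ 1)).mapsTo_Icc
  have hmaps₂ : MapsTo g (Icc (a 0 - a 1) (a 0)) (Icc (g (a 0 - a 1)) (g (a 0))) :=
    (monotoneOn_units_mul_sin (hμ 2) (hμ 1)).mapsTo_Icc
  have hmaps₃ : MapsTo g (Icc (a 0 - a 1) (a 0 - a 1 + a 2))
      (Icc (g (a 0 - a 1)) (g (a 0 - a 1 + a 2))) :=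
    (monotoneOn_units_mul_sin (hμ 2) (hμ 3)).mapsTo_Icc
  have hle₁ := (hmaps₁ (left_mem_Icc.2 (ha 0).le)).2
  have hle₂ := (hmaps₂ (left_mem_Icc.2 (sub_le_self _ (ha 1).le))).2
  have hle₃ := (hmaps₃ (left_mem_Icc.2 (le_add_of_nonneg_right (ha 2).le))).2
  rw [base_threeArcs_sum hu ha]
  obtain ⟨t, ht, rfl⟩ | ⟨t, ht, rfl⟩ | ⟨t, ht, rfl⟩ := exists_of_mem_threeArcsTrace hu (ha 1).le hz
  all_goals
    simp only [two_mul, mul_add (cis (-μ)), mul_sub (cis (-μ)), mul_add ((ε : ℤ) * Complex.I),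
      mul_sub ((ε : ℤ) * Complex.I), Complex.add_re, Complex.sub_re, hproj, hproj₀]
  · obtain ⟨hl, hr⟩ := hmaps₁ ht
    constructor <;> linarith
  · obtain ⟨hl, hr⟩ := hmaps₂ ht
    constructor <;> linarith
  · obtain ⟨hl, hr⟩ := hmaps₃ ht
    constructor <;> linarith

/- If `β₁` is the direction in which the path of opposite orientation ends its first arc, then the
centre of the disc is the midpoint between the centres of the middle circles of the two paths. -/
theorem norm_sub_lt_two_of_mem_threeArcsTrace {β₁ β₂ : ℝ} (hβ₁ : |β₁ - μ| < π / 2)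
    (hβ₂ : |β₂ - μ| < π / 2) (hφ : φ ∈ uIcc (φ + (ε : ℤ) * a 0) β₁)
    (hclose : cis φ + cis (φ + (ε : ℤ) * (a 0 - a 1)) + cis β₂ =
      cis (φ + (ε : ℤ) * a 0) + cis β₁ + cis (φ + (ε : ℤ) * (a 0 - a 1 + a 2)))
    {z : ℂ} (hz : z ∈ u.threeArcsTrace ε a) :
    ‖z - (u.base + (ε : ℤ) * Complex.I * (cis β₁ - cis (φ + (ε : ℤ) * a 0)))‖ < 2 := by
  have hnorm : ∀ w, ‖((ε : ℤ) : ℂ) * Complex.I * w‖ = ‖w‖ := fun w => by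
    rw [norm_mul, norm_mul, Complex.norm_I, Complex.norm_intCast, mul_one, ← Int.cast_abs,
      Int.isUnit_iff_abs_eq.1 ε.isUnit, Int.cast_one, one_mul]
  have hdist : ∀ {α β : ℝ}, |α - μ| < π / 2 → |β - μ| < π / 2 → |α - β| < π := fun hα hβ => by
    rw [abs_lt] at *
    constructor <;> linarith
  have h₀ : |φ - μ| < π / 2 := by simpa [turning] using hμ 0
  have h₁ : |φ + (ε : ℤ) * a 0 - μ| < π / 2 := hμ 1
  have h₂ : |φ + (ε : ℤ) * (a 0 - a 1) - μ| < π / 2 := hμ 2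
  have h₃ : |φ + (ε : ℤ) * (a 0 - a 1 + a 2) - μ| < π / 2 := hμ 3
  obtain ⟨t, ht, rfl⟩ | ⟨t, ht, rfl⟩ | ⟨t, ht, rfl⟩ := exists_of_mem_threeArcsTrace hu (ha 1).le hz
  · have hmem := add_units_mul_mem_uIcc φ ε ht
    rw [mul_zero, add_zero] at hmem
    rw [add_sub_add_left_eq_sub, ← mul_sub, hnorm]
    refine (congrArg norm ?_).trans_lt (norm_cis_add_cis_sub_cis_sub_cis_lt_two hmem
      (hdist h₀ h₁) (hdist h₀ hβ₁) (hdist h₁ hβ₁))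
    ring
  · have hτ := abs_add_units_mul_sub_lt ht h₂ h₁
    rw [add_sub_add_left_eq_sub, ← mul_sub, hnorm, ← norm_neg (_ - _)]
    refine (congrArg norm ?_).trans_lt (norm_cis_add_cis_sub_cis_sub_cis_lt_two hφ
      (hdist h₁ hβ₁) (hdist h₁ hτ) (hdist hβ₁ hτ))
    ring
  · rw [add_sub_add_left_eq_sub, ← mul_sub, hnorm]
    refine (congrArg norm ?_).trans_lt (norm_cis_add_cis_sub_cis_sub_cis_lt_two
      (add_units_mul_mem_uIcc φ ε ht) (hdist h₂ h₃) (hdist h₂ hβ₂) (hdist h₃ hβ₂))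
    linear_combination hclose

end

end UnitTangent

namespace UnitTangent

section Confinement

variable {x : UnitTangent} {φ : ℝ} (hφ : x.dir = cis φ) {a b : Fin 3 → ℝ}

section

variable (ha : ∀ i, 0 < a i) (hb : ∀ i, 0 < b i)
  (hend : x.threeArcs 1 a (a 0 + a 1 + a 2) = x.threeArcs (-1) b (b 0 + b 1 + b 2))

include hφ ha hb hend

theorem cis_add_eq_cis_sub_of_threeArcs_eq :
    cis (φ + (a 0 - a 1 + a 2)) = cis (φ - (b 0 - b 1 + b 2)) := by
  have hdir := congrArg dir hend
  rw [dir_threeArcs_sum hφ ha, dir_threeArcs_sum hφ hb] at hdir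
  simpa only [Units.val_one, Units.val_neg, Int.cast_one, Int.cast_neg, one_mul, neg_one_mul,
    ← sub_eq_add_neg] using hdir

theorem cis_add_cis_add_cis_eq_of_threeArcs_eq :
    cis φ + cis (φ + (a 0 - a 1)) + cis (φ - (b 0 - b 1)) =
      cis (φ + a 0) + cis (φ - b 0) + cis (φ + (a 0 - a 1 + a 2)) := by
  have hdir := cis_add_eq_cis_sub_of_threeArcs_eq hφ ha hb hend
  have hbase := congrArg base hend
  rw [base_threeArcs_sum hφ ha, base_threeArcs_sum hφ hb] at hbase
  simp only [Units.val_one, Units.val_neg, Int.cast_one, Int.cast_neg, one_mul, neg_one_mul,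
    ← sub_eq_add_neg] at hbase
  refine mul_left_cancel₀ Complex.I_ne_zero ?_
  linear_combination hbase / 2 - Complex.I / 2 * hdir

end

include hφ

theorem threeArcsTrace_union_subset_ball {μ : ℝ} (ha : ∀ i, 0 < a i) (hb : ∀ i, 0 < b i)
    (hend : x.threeArcs 1 a (a 0 + a 1 + a 2) = x.threeArcs (-1) b (b 0 + b 1 + b 2))
    (hμ : ∀ i, |φ + turning a i - μ| < π / 2 ∧ |φ - turning b i - μ| < π / 2) :
    x.threeArcsTrace 1 a ∪ x.threeArcsTrace (-1) b ⊆
      Metric.ball (x.base + Complex.I * (cis (φ - b 0) - cis (φ + a 0))) 2 := by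
  have hclose := cis_add_cis_add_cis_eq_of_threeArcs_eq hφ ha hb hend
  have hclose' : cis φ + cis (φ - (b 0 - b 1)) + cis (φ + (a 0 - a 1)) =
      cis (φ - b 0) + cis (φ + a 0) + cis (φ - (b 0 - b 1 + b 2)) := by
    linear_combination hclose + cis_add_eq_cis_sub_of_threeArcs_eq hφ ha hb hend
  have h₁ : |φ + a 0 - μ| < π / 2 ∧ |φ - b 0 - μ| < π / 2 := hμ 1
  have h₂ : |φ + (a 0 - a 1) - μ| < π / 2 ∧ |φ - (b 0 - b 1) - μ| < π / 2 := hμ 2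
  have hmem : φ ∈ Icc (φ - b 0) (φ + a 0) := ⟨by linarith [hb 0], by linarith [ha 0]⟩
  rintro z (hz | hz) <;> rw [mem_ball_iff_norm]
  · have hlt := norm_sub_lt_two_of_mem_threeArcsTrace hφ ha (μ := μ) (fun i => by
        simpa using (hμ i).1) h₁.2 h₂.2
      (by simpa using Icc_subset_uIcc' hmem) (by simpa using hclose) hz
    simpa using hlt
  · have hlt := norm_sub_lt_two_of_mem_threeArcsTrace hφ hb (μ := μ) (fun i => by
        simpa [← sub_eq_add_neg] using (hμ i).2) h₁.1 h₂.1
      (by simpa [← sub_eq_add_neg] using Icc_subset_uIcc hmem)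
      (by simpa only [Units.val_neg, Units.val_one, Int.cast_neg, Int.cast_one, neg_one_mul,
        ← sub_eq_add_neg] using hclose') hz
    refine (congrArg norm ?_).trans_lt hlt
    simp only [Units.val_neg, Units.val_one, Int.cast_neg, Int.cast_one, neg_one_mul,
      ← sub_eq_add_neg]
    ring

theorem exists_forall_mem_closedBall_and_re_mem_Icc_of_threeArcs_eq
    (ha : ∀ i, a i ∈ Ioo 0 π) (hb : ∀ i, b i ∈ Ioo 0 π)
    (hend : x.threeArcs 1 a (a 0 + a 1 + a 2) = x.threeArcs (-1) b (b 0 + b 1 + b 2)) :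
    ∃ (O : ℂ) (r μ : ℝ), r < 2 ∧ ∀ z ∈ x.threeArcsTrace 1 a ∪ x.threeArcsTrace (-1) b,
      z ∈ Metric.closedBall O r ∧ (cis (-μ) * z).re ∈ Icc (cis (-μ) * x.base).re
        (cis (-μ) * (x.threeArcs 1 a (a 0 + a 1 + a 2)).base).re := by
  have ha₀ := fun i => (ha i).1
  have hb₀ := fun i => (hb i).1
  obtain ⟨μ, hμ⟩ := exists_forall_abs_turning_sub_lt_of_closing ha hb
    (cis_add_eq_cis_sub_of_threeArcs_eq hφ ha₀ hb₀ hend)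
    (cis_add_cis_add_cis_eq_of_threeArcs_eq hφ ha₀ hb₀ hend)
  obtain ⟨r, hr, hball⟩ := exists_lt_subset_ball
    ((x.isCompact_threeArcsTrace 1 (ha₀ 1).le).union
      (x.isCompact_threeArcsTrace (-1) (hb₀ 1).le)).isClosed
    (threeArcsTrace_union_subset_ball hφ ha₀ hb₀ hend hμ)
  refine ⟨_, r, μ, hr, fun z hz => ⟨Metric.ball_subset_closedBall (hball hz), ?_⟩⟩
  rcases hz with hz | hz
  · refine re_cis_neg_mul_mem_Icc_of_mem_threeArcsTrace hφ ha₀ (fun i => ?_) hz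
    simpa using (hμ i).1
  · refine hend ▸ re_cis_neg_mul_mem_Icc_of_mem_threeArcsTrace hφ hb₀ (fun i => ?_) hz
    simpa [← sub_eq_add_neg] using (hμ i).2

end Confinement

end UnitTangent

/-! ### Length bounds -/

theorem HasTangentAngle.length_le_of_injOn {Γ : ℝ → ℂ} {θ : ℝ → ℝ} (h : HasTangentAngle Γ θ)
    {s r ω μ : ℝ} {O : ℂ} (hs : 0 < s) (hinj : InjOn Γ (Icc 0 s)) (hω₀ : 0 ≤ ω) (hω : ω < π)
    (hr : r < 1 - cos ω) (hball : ∀ t ∈ Icc 0 s, Γ t ∈ Metric.closedBall O r)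
    (hstrip : ∀ t ∈ Icc 0 s,
      (cis (-μ) * Γ t).re ∈ Icc (cis (-μ) * Γ 0).re (cis (-μ) * Γ s).re) :
    s ≤ ((2 * π + ω) / (π - ω) + 1) * ((16 * r + 1) * (4 * r + 1)) := by
  have hr₀ : 0 ≤ r := dist_nonneg.trans (hball 0 (left_mem_Icc.2 hs.le))
  have hdist : ∀ t ∈ Icc 0 s, ∀ t' ∈ Icc 0 s, dist (Γ t) (Γ t') ≤ 2 * r := fun t ht t' ht' =>
    (dist_triangle_right _ _ O).trans (by
      linarith [Metric.mem_closedBall.1 (hball t ht), Metric.mem_closedBall.1 (hball t' ht')])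
  have hdist_lt : ∀ t ∈ Icc 0 s, ∀ t' ∈ Icc 0 s, dist (Γ t) (Γ t') < 2 * (1 - cos ω) :=
    fun t ht t' ht' => (hdist t ht t' ht').trans_lt (by linarith)
  have hturn : |θ s - θ 0| ≤ 2 * π := by
    simpa using (h.rotate μ).abs_sub_le_two_pi_of_injOn hs
      (fun t ht t' ht' heq => hinj ht ht' (mul_left_cancel₀ (cis_ne_zero _) heq)) hstrip
  have hvalley := h.conj.noPeak hω₀ hω.le (s := s) fun t ht t' ht' => by
    simpa using hdist_lt t ht t' ht'
  refine (h.noPeak hω₀ hω.le hdist_lt).le_of_abs_sub_le hvalley hω (by positivity)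
    (fun a ha has => ?_) hturn (by positivity)
  have hsub := Icc_subset_Icc ha has
  exact h.risesOn_pi_or_neg (le_add_of_nonneg_right (by positivity))
    (fun t ht t' ht' => hdist t (hsub ht) t' (hsub ht'))
    (by linarith)

theorem exists_lt_one_sub_cos {r : ℝ} (hr : r < 2) : ∃ ω, 0 ≤ ω ∧ ω < π ∧ r < 1 - cos ω := by
  have hcont : ContinuousWithinAt (fun ω => 1 - cos ω) (Iio π) π := by fun_prop
  have hπ : r < 1 - cos π := by rw [cos_pi]; linarith
  obtain ⟨ω, hrω, hω⟩ :=
    ((hcont.eventually (lt_mem_nhds hπ)).and (Ioo_mem_nhdsLT pi_pos)).exists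
  exact ⟨ω, hω.1.le, hω.2, hrω⟩

theorem IsBoundedCurvaturePath.length_le_of_injOn {x y : UnitTangent} {s : ℝ} {γ : ℝ → ℂ}
    (h : IsBoundedCurvaturePath x y s γ) (hinj : InjOn γ (Icc 0 s)) {r ω μ : ℝ} {O : ℂ}
    (hω₀ : 0 ≤ ω) (hω : ω < π) (hr : r < 1 - cos ω)
    (hconf : ∀ t ∈ Icc 0 s, γ t ∈ Metric.closedBall O r ∧
      (cis (-μ) * γ t).re ∈ Icc (cis (-μ) * x.base).re (cis (-μ) * y.base).re) :
    s ≤ ((2 * π + ω) / (π - ω) + 1) * ((16 * r + 1) * (4 * r + 1)) := by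
  obtain ⟨Γ, θ, hΓ, hΓγ, -⟩ := h.exists_hasTangentAngle
  refine hΓ.length_le_of_injOn h.pos (hΓγ.injOn_iff.2 hinj) hω₀ hω hr
    (fun t ht => hΓγ ht ▸ (hconf t ht).1) (μ := μ) fun t ht => ?_
  rw [hΓγ ht, hΓγ (left_mem_Icc.2 h.pos.le), hΓγ (right_mem_Icc.2 h.pos.le), h.start_base,
    h.end_base]
  exact (hconf t ht).2

theorem mainTheorem4_general {x y : UnitTangent} {a b : Fin 3 → ℝ}
    (ha : ∀ i, a i ∈ Ioo 0 π) (hb : ∀ i, b i ∈ Ioo 0 π)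
    (hxa : x.threeArcs 1 a (a 0 + a 1 + a 2) = y)
    (hxb : x.threeArcs (-1) b (b 0 + b 1 + b 2) = y) :
    (∃ L : ℝ, ∀ (s : ℝ) (γ : ℝ → ℂ), (s, γ) ∈ embeddedPathsIn x y
      (closure (boundedComplement (x.threeArcsTrace 1 a ∪ x.threeArcsTrace (-1) b))) → s ≤ L) ∧
    ∀ (s : ℝ) (γ : ℝ → ℂ), IsBoundedCurvaturePath x y s γ → 297 ≤ s →
      4 < Metric.diam (γ '' Icc 0 s) ∨ HasParallelTangents s γ := by
  refine ⟨?_, fun s γ hγ hs => or_iff_not_imp_left.2 fun hdiam =>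
    hγ.hasParallelTangents_of_diam_le (not_lt.1 hdiam) hs⟩
  obtain ⟨O, r, μ, hr, hC⟩ := x.exists_forall_mem_closedBall_and_re_mem_Icc_of_threeArcs_eq
    x.dir_eq_cis_arg ha hb (hxa.trans hxb.symm)
  obtain ⟨ω, hω₀, hω, hrω⟩ := exists_lt_one_sub_cos hr
  have hΩ := closure_boundedComplement_subset
    ((x.threeArcsTrace_nonempty 1 fun i => (ha i).1.le).mono subset_union_left)
    ((convex_closedBall O r).inter (convex_setOf_re_mul_mem_Icc _ _ _))
    (Metric.isClosed_closedBall.inter (isClosed_setOf_re_mul_mem_Icc _ _ _)) hC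
  rw [hxa] at hΩ
  exact ⟨((2 * π + ω) / (π - ω) + 1) * ((16 * r + 1) * (4 * r + 1)), fun s γ ⟨hγ, hinj, hmem⟩ =>
    hγ.length_le_of_injOn hinj hω₀ hω hrω fun t ht => hΩ (hmem t ht)⟩

theorem mainTheorem4 (x y : UnitTangent) (Ω : Set ℂ)
    (hy : y.base ∈ x.forwardRegion) (hΩ : CarriesRegion x y Ω) :
    (∃ L : ℝ, ∀ (s : ℝ) (γ : ℝ → ℂ), (s, γ) ∈ embeddedPathsIn x y Ω → s ≤ L) ∧
    (∃ L : ℝ, ∀ (s : ℝ) (γ : ℝ → ℂ), IsBoundedCurvaturePath x y s γ → L < s →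
      (∃ t ∈ Set.Icc 0 s, γ t ∉ Ω) ∨
      4 < Metric.diam (γ '' Set.Icc 0 s) ∨
      HasParallelTangents s γ) := by
  obtain ⟨-, -, a, b, ha, hb, -, rfl⟩ := hΩ
  obtain ⟨hlength, hlong⟩ := mainTheorem4_general (fun i => ⟨ha.pos i, ha.lt_pi i⟩)
    (fun i => ⟨hb.pos i, hb.lt_pi i⟩) ha.endpoint hb.endpoint
  exact ⟨hlength, 297, fun s γ hγ hs => .inr (hlong s γ hγ hs.le)⟩
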